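/- Let $\mathcal X$ be a smooth finite-dimensional manifold (without boundary, not necessarily compact) with a smooth Riemannian metric, and let $\mathcal A\colon\mathcal X\to\mathbb R$ be a smooth Morse function with gradient $\nabla\mathcal A$. On $\pi\colon T^*\mathcal X\to\mathcal X$ let $\omega=d\lambda=\sum_i dp_i\wedge dq_i$ be the canonical symplectic form, where $\lambda_\xi=\xi\circ d\pi$. Let $J$ be the $\omega$-compatible almost complex structure on $T^*\mathcal X$ induced by the metric: with respect to the splitting $T(T^*\mathcal X)=\pi^*T\mathcal X\oplus\pi^*T^*\mathcal X\cong\pi^*T\mathcal X\oplus\pi^*T\mathcal X$ into horizontal and vertical vectors given by the Levi-Civita connection and the metric, $J(h,v)=(v,-h)$. Let $\mathcal H\colon T^*\mathcal X\to\mathbb R$, $\mathcal H(\xi)=\xi(\nabla\mathcal A)$, and let $X_{\mathcal H}$ be its Hamiltonian vector field, $\omega(\cdot,X_{\mathcal H})=d\mathcal H$. Let $u\colon\mathbb R\times[0,1]\to T^*\mathcal X$, with coordinates $(t,\tau)$ on the domain, be a $C^2$ map which satisfies $$\partial_t u+J(u)\,\partial_\tau u+X_{\mathcal H}(u)=0,$$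 takes values in the zero section for $\tau=0$ and $\tau=1$, and converges, uniformly in $\tau$, to a critical point of $\mathcal H$ as $t\to-\infty$ and to a critical point of $\mathcal H$ as $t\to+\infty$. Then $\partial_\tau u=0$, $u$ is contained in the zero section, and $u$ corresponds to a (negative) gradient trajectory of $\mathcal A$: there is a curve $v\colon\mathbb R\to\mathcal X$ with $v'(t)+\nabla\mathcal A(v(t))=0$ for all $t$, converging to critical points of $\mathcal A$ as $t\to\pm\infty$, such that $u(t,\tau)=0\in T^*_{v(t)}\mathcal X$ for all $(t,\tau)$. Conversely, for every such curve $v$, the map $(t,\tau)\mapsto 0\in T^*_{v(t)}\mathcal X$ is such a solution $u$. No smallness assumption on $\mathcal A$ is made. -/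

import Mathlib

open scoped Manifold ContDiff Topology

noncomputable section

/-! Throughout, Mathlib's tangent space of a manifold at a point `x` is the model vector space: a
tangent vector at `x` is given by its coordinates in the preferred chart `extChartAt I x`. -/

namespace CotangentFloer

variable {E : Type*} [NormedAddCommGroup E] [NormedSpace ℝ E]

section OneForms

variable {B : Type*} [TopologicalSpace B] {I : ModelWithCorners ℝ E B}
  {N : Type*} [TopologicalSpace N] [ChartedSpace B N]

/-- The coordinate expression of a one-form `θ` in the preferred chart `φ` at `x`: the pull-back of
`θ` under `φ⁻¹`, a one-form on (an open subset of) the model vector space. -/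
def oneFormInChart (θ : ∀ y : N, TangentSpace I y →L[ℝ] ℝ) (x : N) (e : E) : E →L[ℝ] ℝ :=
  (θ ((extChartAt I x).symm e)).comp (mfderiv 𝓘(ℝ, E) I (extChartAt I x).symm e)

/-- The exterior derivative of a one-form on a manifold without boundary. If `θ = ∑ θᵢ dxⁱ` in the
preferred chart at `x`, then `dθ(a, b) = ∑ (∂ᵢθⱼ - ∂ⱼθᵢ) aⁱ bʲ`. -/
def extDerivOneForm (θ : ∀ y : N, TangentSpace I y →L[ℝ] ℝ) (x : N) (a b : TangentSpace I x) : ℝ :=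
  let Dθ : E →L[ℝ] E →L[ℝ] ℝ := fderiv ℝ (oneFormInChart θ x) (extChartAt I x x)
  Dθ a b - Dθ b a

end OneForms

variable {M : Type*} [TopologicalSpace M] [ChartedSpace E M] [IsManifold 𝓘(ℝ, E) ∞ M]

variable (E M) in
/-- The cotangent bundle of `M`, with the manifold structure of the bundle `Hom(TM, ℝ)`: its charts
are the canonical coordinates `(q, p)` induced by the charts of `M`. -/
abbrev CotangentBundle : Type _ :=
  Bundle.TotalSpace (E →L[ℝ] ℝ)
    (fun x : M => TangentSpace 𝓘(ℝ, E) x →L[ℝ] Bundle.Trivial M ℝ x)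

variable (E) in
/-- The model of the cotangent bundle as a manifold. -/
abbrev cotModel : ModelWithCorners ℝ (E × (E →L[ℝ] ℝ)) (ModelProd E (E →L[ℝ] ℝ)) :=
  (𝓘(ℝ, E)).prod 𝓘(ℝ, E →L[ℝ] ℝ)

/-- The covector underlying a point of the cotangent bundle. -/
abbrev covector (ξ : CotangentBundle E M) : TangentSpace 𝓘(ℝ, E) ξ.proj →L[ℝ] ℝ := ξ.snd

/-- The differential of the projection `T*M → M`. -/
def dproj (ξ : CotangentBundle E M) :
    TangentSpace (cotModel E) ξ →L[ℝ] TangentSpace 𝓘(ℝ, E) ξ.proj :=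
  mfderiv (cotModel E) 𝓘(ℝ, E)
    (Bundle.TotalSpace.proj : CotangentBundle E M → M) ξ

/-- The tautological one-form `λ_ξ = ξ ∘ dπ`, that is `λ = ∑ pᵢ dqᵢ`. -/
def tautologicalForm (ξ : CotangentBundle E M) : TangentSpace (cotModel E) ξ →L[ℝ] ℝ :=
  (covector ξ).comp (dproj ξ)

/-- The canonical symplectic form `ω = dλ = ∑ dpᵢ ∧ dqᵢ`. -/
def symplecticForm (ξ : CotangentBundle E M) (z w : TangentSpace (cotModel E) ξ) : ℝ :=
  extDerivOneForm (I := cotModel E) tautologicalForm ξ z w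

/-- The differential of a function on the cotangent bundle. -/
def dfun (H : CotangentBundle E M → ℝ) (ξ : CotangentBundle E M) :
    TangentSpace (cotModel E) ξ →L[ℝ] ℝ :=
  mfderiv (cotModel E) 𝓘(ℝ, ℝ) H ξ

theorem proj_extChartAt_symm (ξ : CotangentBundle E M) :
    ∀ e' ∈ (extChartAt (cotModel E) ξ).target,
      ((extChartAt (cotModel E) ξ).symm e').proj ∈ (chartAt E ξ.proj).source ∧
    ((extChartAt (cotModel E) ξ).symm e').proj = (extChartAt 𝓘(ℝ, E) ξ.proj).symm e'.1 := by
  intro e' he'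
  have h1 := (extChartAt (cotModel E) ξ).right_inv he'
  have h2 := (extChartAt (cotModel E) ξ).map_target he'
  set η' := (extChartAt (cotModel E) ξ).symm e'
  have h3 : η'.proj ∈ (chartAt E ξ.proj).source := by
    rw [FiberBundle.extChartAt, PartialEquiv.trans_source] at h2
    have h5 := (Bundle.Trivialization.mem_source _).1 h2.1
    rw [hom_trivializationAt_baseSet] at h5
    simpa [mfld_simps] using h5.1
  have h4 : extChartAt 𝓘(ℝ, E) ξ.proj η'.proj = e'.1 := by
    rw [← h1]; rfl
  exact ⟨h3, by rw [← h4, (extChartAt 𝓘(ℝ, E) ξ.proj).left_inv (by simpa using h3)]⟩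

/-- In canonical coordinates, the differential of the projection is `(q̇, ṗ) ↦ q̇`. -/
theorem dproj_apply (ξ : CotangentBundle E M) (z : TangentSpace (cotModel E) ξ) :
    dproj ξ z = z.1 := by
  have hm : MDifferentiableAt (cotModel E) 𝓘(ℝ, E)
      (Bundle.TotalSpace.proj : CotangentBundle E M → M) ξ := Bundle.mdifferentiableAt_proj _
  have h : writtenInExtChartAt (cotModel E) 𝓘(ℝ, E) ξ
      (Bundle.TotalSpace.proj : CotangentBundle E M → M) =ᶠ[𝓝 (extChartAt (cotModel E) ξ ξ)]
      (Prod.fst : E × (E →L[ℝ] ℝ) → E) := by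
    filter_upwards [extChartAt_target_mem_nhds (I := cotModel E) ξ] with e he
    obtain ⟨h1, h2⟩ := proj_extChartAt_symm ξ e he
    have h3 : ((extChartAt (cotModel E) ξ).symm e).proj ∈ (extChartAt 𝓘(ℝ, E) ξ.proj).source := by
      rwa [extChartAt_source]
    have h4 := congrArg (extChartAt 𝓘(ℝ, E) ξ.proj) h2
    refine h4.trans ((extChartAt 𝓘(ℝ, E) ξ.proj).right_inv ?_)
    rw [FiberBundle.extChartAt_target] at he
    exact he.1.1
  have h5 : dproj ξ = fderiv ℝ (Prod.fst : E × (E →L[ℝ] ℝ) → E) (extChartAt (cotModel E) ξ ξ) := by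
    rw [← h.fderiv_eq]
    unfold dproj
    rw [hm.mfderiv, ModelWithCorners.range_eq_univ, fderivWithin_univ]
  rw [fderiv_fst] at h5
  exact congrArg (fun T : E × (E →L[ℝ] ℝ) →L[ℝ] E => T z) h5

theorem oneFormInChart_tautologicalForm (ξ : CotangentBundle E M) :
    oneFormInChart (I := cotModel E) tautologicalForm ξ =ᶠ[𝓝 (extChartAt (cotModel E) ξ ξ)]
      fun e => e.2.comp (ContinuousLinearMap.fst ℝ E (E →L[ℝ] ℝ)) := by
  have ht : (extChartAt (cotModel E) ξ).target ∈ 𝓝 (extChartAt (cotModel E) ξ ξ) :=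
    extChartAt_target_mem_nhds ξ
  filter_upwards [ht] with e he
  set η := (extChartAt (cotModel E) ξ).symm e with hη
  have hr : extChartAt (cotModel E) ξ η = e := (extChartAt (cotModel E) ξ).right_inv he
  have hproj := proj_extChartAt_symm ξ
  obtain ⟨hsrc, hpe⟩ := hproj e he
  have hq : extChartAt 𝓘(ℝ, E) ξ.proj η.proj = e.1 := by rw [← hr]; rfl
  have hd : ∀ w : E × (E →L[ℝ] ℝ), dproj η
      (mfderiv 𝓘(ℝ, E × (E →L[ℝ] ℝ)) (cotModel E) (extChartAt (cotModel E) ξ).symm e w) =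
      mfderiv 𝓘(ℝ, E) 𝓘(ℝ, E) (extChartAt 𝓘(ℝ, E) ξ.proj).symm e.1 w.1 := by
    intro w
    have hm : MDifferentiableAt 𝓘(ℝ, E × (E →L[ℝ] ℝ)) (cotModel E)
        (extChartAt (cotModel E) ξ).symm e := by
      have := mdifferentiableWithinAt_extChartAt_symm (I := cotModel E) he
      rwa [ModelWithCorners.range_eq_univ, mdifferentiableWithinAt_univ] at this
    have hm2 : MDifferentiableAt 𝓘(ℝ, E) 𝓘(ℝ, E) (extChartAt 𝓘(ℝ, E) ξ.proj).symm e.1 := by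
      have h6 : e.1 ∈ (extChartAt 𝓘(ℝ, E) ξ.proj).target := by
        rw [← hq]; exact (extChartAt 𝓘(ℝ, E) ξ.proj).map_source (by
          rw [extChartAt_source]; exact hsrc)
      have := mdifferentiableWithinAt_extChartAt_symm (I := 𝓘(ℝ, E)) h6
      rwa [ModelWithCorners.range_eq_univ, mdifferentiableWithinAt_univ] at this
    have hpm : MDifferentiableAt (cotModel E) 𝓘(ℝ, E)
        (Bundle.TotalSpace.proj : CotangentBundle E M → M) η :=
      Bundle.mdifferentiableAt_proj _
    have c1 := mfderiv_comp_apply e hpm hm w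
    have hfst : MDifferentiableAt 𝓘(ℝ, E × (E →L[ℝ] ℝ)) 𝓘(ℝ, E)
        (Prod.fst : E × (E →L[ℝ] ℝ) → E) e := differentiableAt_fst.mdifferentiableAt
    have c2 := mfderiv_comp_apply e hm2 hfst w
    have hee : (Bundle.TotalSpace.proj : CotangentBundle E M → M) ∘
        (extChartAt (cotModel E) ξ).symm =ᶠ[𝓝 e]
        (extChartAt 𝓘(ℝ, E) ξ.proj).symm ∘ (Prod.fst : E × (E →L[ℝ] ℝ) → E) := by
      filter_upwards [(isOpen_extChartAt_target ξ).mem_nhds he] with e' he'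
      exact (hproj e' he').2
    have c3 := hee.mfderiv_eq (I := 𝓘(ℝ, E × (E →L[ℝ] ℝ))) (I' := 𝓘(ℝ, E))
    have c4 := congrArg (fun T : E × (E →L[ℝ] ℝ) →L[ℝ] E => T w) c3
    refine c1.symm.trans (c4.trans (c2.trans ?_))
    congr 1
    rw [mfderiv_eq_fderiv, fderiv_fst]
    rfl
  have hp : ∀ w : E, η.snd
      (mfderiv 𝓘(ℝ, E) 𝓘(ℝ, E) (extChartAt 𝓘(ℝ, E) ξ.proj).symm e.1 w) = e.2 w := by
    intro w
    have h7 : ContinuousLinearMap.inCoordinates E (TangentSpace 𝓘(ℝ, E)) ℝ (Bundle.Trivial M ℝ)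
        ξ.proj η.proj ξ.proj η.proj η.snd = e.2 := by
      rw [← hr]; rfl
    have h8 := TangentBundle.symmL_trivializationAt (I := 𝓘(ℝ, E)) (x₀ := ξ.proj) (x := η.proj) hsrc
    rw [ModelWithCorners.range_eq_univ, mfderivWithin_univ, hq] at h8
    have h9 : ContinuousLinearMap.inCoordinates E (TangentSpace 𝓘(ℝ, E)) ℝ (Bundle.Trivial M ℝ)
        ξ.proj η.proj ξ.proj η.proj η.snd w = η.snd (Bundle.Trivialization.symmL ℝ
          (trivializationAt E (TangentSpace 𝓘(ℝ, E)) ξ.proj) η.proj w) := by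
      simp [ContinuousLinearMap.inCoordinates]
    rw [← h8, ← h7]
    exact h9.symm
  refine ContinuousLinearMap.ext fun w => ?_
  change η.snd (dproj η (mfderiv 𝓘(ℝ, E × (E →L[ℝ] ℝ)) (cotModel E)
    (extChartAt (cotModel E) ξ).symm e w)) = e.2 w.1
  rw [hd]
  exact hp _

/-- In canonical coordinates, `ω((a, α), (b, β)) = α(b) - β(a)`. -/
theorem symplecticForm_apply (ξ : CotangentBundle E M) (z w : TangentSpace (cotModel E) ξ) :
    symplecticForm ξ z w = z.2 w.1 - w.2 z.1 := by
  have h := (oneFormInChart_tautologicalForm ξ).fderiv_eq (𝕜 := ℝ)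
  have h2 : fderiv ℝ (fun e : E × (E →L[ℝ] ℝ) => e.2.comp (ContinuousLinearMap.fst ℝ E (E →L[ℝ] ℝ)))
      (extChartAt (cotModel E) ξ ξ) =
      ((ContinuousLinearMap.compL ℝ (E × (E →L[ℝ] ℝ)) E ℝ).flip
        (ContinuousLinearMap.fst ℝ E (E →L[ℝ] ℝ))).comp
          (ContinuousLinearMap.snd ℝ E (E →L[ℝ] ℝ)) := by
    exact ContinuousLinearMap.fderiv (((ContinuousLinearMap.compL ℝ (E × (E →L[ℝ] ℝ)) E ℝ).flip
        (ContinuousLinearMap.fst ℝ E (E →L[ℝ] ℝ))).comp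
          (ContinuousLinearMap.snd ℝ E (E →L[ℝ] ℝ)))
  rw [h2] at h
  unfold symplecticForm extDerivOneForm
  simp only [h]
  rfl

variable (E M) in
/-- Smooth Riemannian metrics on `M`. -/
abbrev Metric : Type _ :=
  Bundle.ContMDiffRiemannianMetric 𝓘(ℝ, E) ∞ E (fun x : M => TangentSpace 𝓘(ℝ, E) x)

/-- The matrix `(g_ij)` of the metric in the preferred chart at `x`, as a function on (an open
subset of) the model vector space with values in bilinear forms. -/
def metricInChart (g : Metric E M) (x : M) (e : E) : E →L[ℝ] E →L[ℝ] ℝ :=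
  let G : E →L[ℝ] E →L[ℝ] ℝ := g.inner ((extChartAt 𝓘(ℝ, E) x).symm e)
  let P : E →L[ℝ] E := mfderiv 𝓘(ℝ, E) 𝓘(ℝ, E) (extChartAt 𝓘(ℝ, E) x).symm e
  G.bilinearComp P P

/-- The derivative at `x` of the matrix of the metric: `metricDeriv g x a b c = a(g(b, c))` for
constant coordinate vector fields `b` and `c`. -/
def metricDeriv (g : Metric E M) (x : M) : E →L[ℝ] E →L[ℝ] E →L[ℝ] ℝ :=
  fderiv ℝ (metricInChart g x) (extChartAt 𝓘(ℝ, E) x x)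

theorem fderiv_symm_of_symm {F : E → E →L[ℝ] E →L[ℝ] ℝ} (hF : ∀ e v w, F e v w = F e w v)
    (x s a b : E) : fderiv ℝ F x s a b = fderiv ℝ F x s b a := by
  by_cases h : DifferentiableAt ℝ F x
  · have key : ∀ v w : E, HasFDerivAt (fun e => F e v w)
        (((fderiv ℝ F x).flip v).flip w) x := fun v w => by
      simpa using (h.hasFDerivAt.clm_apply (hasFDerivAt_const v x)).clm_apply
        (hasFDerivAt_const w x)
    have hab := key a b
    simp only [hF _ a b] at hab
    exact congrArg (fun T : E →L[ℝ] ℝ => T s) (hab.unique (key b a))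
  · simp [fderiv_zero_of_not_differentiableAt h]

theorem metricInChart_symm (g : Metric E M) (x : M) (e v w : E) :
    metricInChart g x e v w = metricInChart g x e w v :=
  g.symm ((extChartAt 𝓘(ℝ, E) x).symm e) _ _

theorem metricDeriv_symm (g : Metric E M) (x : M) (s a b : E) :
    metricDeriv g x s a b = metricDeriv g x s b a := by
  unfold metricDeriv
  exact fderiv_symm_of_symm (metricInChart_symm g x) _ s a b

variable [FiniteDimensional ℝ E]

/-- The symplectic form is nondegenerate: every function has a unique Hamiltonian vector field. -/
theorem existsUnique_hamiltonian (H : CotangentBundle E M → ℝ) (ξ : CotangentBundle E M) :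
    ∃! X : TangentSpace (cotModel E) ξ, ∀ w, symplecticForm ξ w X = dfun H ξ w := by
  let B : (E × (E →L[ℝ] ℝ)) →ₗ[ℝ] Module.Dual ℝ (E × (E →L[ℝ] ℝ)) :=
    LinearMap.mk₂ ℝ (fun X w => w.2 X.1 - X.2 w.1)
      (by intros; simp; ring) (by intros; simp; ring) (by intros; simp; ring)
      (by intros; simp; ring)
  have hB : Function.Injective B := by
    rw [← LinearMap.ker_eq_bot, LinearMap.ker_eq_bot']
    rintro ⟨b, β⟩ h
    have h1 : ∀ w : E × (E →L[ℝ] ℝ), w.2 b - β w.1 = 0 := fun w => congrArg (fun T => T w) h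
    have hb : b = 0 := by
      by_contra hb
      obtain ⟨f, hf⟩ := SeparatingDual.exists_ne_zero (R := ℝ) hb
      exact hf (by simpa using h1 (0, f))
    have hβ : β = 0 := by
      ext a
      simpa using h1 (a, 0)
    rw [hb, hβ]; rfl
  have hS : Function.Surjective B :=
    (LinearMap.injective_iff_surjective_of_finrank_eq_finrank Subspace.dual_finrank_eq.symm).1 hB
  obtain ⟨X, hX⟩ := hS (dfun H ξ : (E × (E →L[ℝ] ℝ)) →L[ℝ] ℝ).toLinearMap
  refine ⟨X, fun w => ?_, fun Y hY => hB ?_⟩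
  · exact (symplecticForm_apply ξ w X).trans (congrArg (fun T => T w) hX)
  · rw [hX]
    refine LinearMap.ext fun w => ?_
    exact (symplecticForm_apply ξ w Y).symm.trans (hY w)

/-- The Hamiltonian vector field `X_H`, given by `ω(·, X_H) = dH`. -/
def hamiltonianVectorField (H : CotangentBundle E M → ℝ) (ξ : CotangentBundle E M) :
    TangentSpace (cotModel E) ξ :=
  (existsUnique_hamiltonian H ξ).choose

theorem symplecticForm_hamiltonianVectorField (H : CotangentBundle E M → ℝ)
    (ξ : CotangentBundle E M) (w : TangentSpace (cotModel E) ξ) :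
    symplecticForm ξ w (hamiltonianVectorField H ξ) = dfun H ξ w :=
  (existsUnique_hamiltonian H ξ).choose_spec.1 w

theorem bijective_inner (g : Metric E M) (x : M) : Function.Bijective (g.inner x) := by
  let B : E →ₗ[ℝ] (E →L[ℝ] ℝ) := (g.inner x).toLinearMap
  have hB : Function.Injective B := by
    rw [← LinearMap.ker_eq_bot, LinearMap.ker_eq_bot']
    intro v hv
    by_contra h0
    exact (g.pos x v h0).ne' (congrArg (fun T : E →L[ℝ] ℝ => T v) hv)
  have hr : Module.finrank ℝ E = Module.finrank ℝ (E →L[ℝ] ℝ) :=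
    (Subspace.dual_finrank_eq (K := ℝ) (V := E)).symm.trans
      (LinearEquiv.finrank_eq LinearMap.toContinuousLinearMap)
  exact ⟨hB, (LinearMap.injective_iff_surjective_of_finrank_eq_finrank hr).1 hB⟩

/-- The isomorphism `T_x M → T_x^* M`, `v ↦ g(v, ·)`. -/
def flat (g : Metric E M) (x : M) :
    TangentSpace 𝓘(ℝ, E) x ≃ₗ[ℝ] (TangentSpace 𝓘(ℝ, E) x →L[ℝ] ℝ) :=
  LinearEquiv.ofBijective (g.inner x).toLinearMap (bijective_inner g x)

/-- The gradient of a function, `g(∇A, ·) = dA`. -/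
def grad (g : Metric E M) (A : M → ℝ) (x : M) : TangentSpace 𝓘(ℝ, E) x :=
  (flat g x).symm (mfderiv 𝓘(ℝ, E) 𝓘(ℝ, ℝ) A x)

/-- The covector `b ↦ ξ(∇_a b)`, where `∇` is the Levi-Civita connection of `g`, and `a` and `b` are
regarded as constant coordinate vector fields in the preferred chart; that is, `b ↦ ξ(Γ(a, b))`, with
`Γ` the Christoffel symbols. It is given by the Koszul formula
`ξ(∇_a b) = g(∇_a b, s) = (a(g(b, s)) + b(g(a, s)) - s(g(a, b))) / 2`
where `s` is the vector dual to `ξ`. -/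
def connectionTerm (g : Metric E M) (ξ : CotangentBundle E M) (a : E) : E →L[ℝ] ℝ :=
  let D : E →L[ℝ] E →L[ℝ] E →L[ℝ] ℝ := metricDeriv g ξ.proj
  let s : E := (flat g ξ.proj).symm (covector ξ)
  (1 / 2 : ℝ) • ((D a).flip s + (D.flip a).flip s - D s a)

theorem connectionTerm_apply (g : Metric E M) (ξ : CotangentBundle E M) (a b : E) :
    connectionTerm g ξ a b =
      (metricDeriv g ξ.proj a b ((flat g ξ.proj).symm (covector ξ)) +
        metricDeriv g ξ.proj b a ((flat g ξ.proj).symm (covector ξ)) -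
        metricDeriv g ξ.proj ((flat g ξ.proj).symm (covector ξ)) a b) / 2 := by
  change (1 / 2 : ℝ) * (metricDeriv g ξ.proj a b ((flat g ξ.proj).symm (covector ξ)) +
        metricDeriv g ξ.proj b a ((flat g ξ.proj).symm (covector ξ)) -
        metricDeriv g ξ.proj ((flat g ξ.proj).symm (covector ξ)) a b) = _
  ring

/-- The vertical part of a vector tangent to `T*M` at `ξ` with respect to the Levi-Civita
connection, a covector at the same base point. In canonical coordinates, `(q̇, ṗ)` has vertical part
`ṗⱼ - Γᵏᵢⱼ q̇ⁱ pₖ`; the vertical part of the velocity of a curve in `T*M`, seen as a one-form along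
its projection to `M`, is its covariant derivative. -/
def verticalPart (g : Metric E M) (ξ : CotangentBundle E M) (z : TangentSpace (cotModel E) ξ) :
    TangentSpace 𝓘(ℝ, E) ξ.proj →L[ℝ] ℝ :=
  (z.2 - connectionTerm g ξ z.1 : E →L[ℝ] ℝ)

/-- The tangent vector at `ξ` with horizontal part `h` and vertical part `β`. -/
def ofHorVert (g : Metric E M) (ξ : CotangentBundle E M) (h : TangentSpace 𝓘(ℝ, E) ξ.proj)
    (β : TangentSpace 𝓘(ℝ, E) ξ.proj →L[ℝ] ℝ) : TangentSpace (cotModel E) ξ :=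
  let β' : E →L[ℝ] ℝ := β
  (h, β' + connectionTerm g ξ h)

/-- The almost complex structure on `T*M` induced by the metric. With respect to the splitting
`T(T*M) = π^*TM ⊕ π^*T^*M ≅ π^*TM ⊕ π^*TM` into horizontal and vertical vectors,
`J(h, v) = (v, -h)`. -/
def almostComplex (g : Metric E M) (ξ : CotangentBundle E M) (z : TangentSpace (cotModel E) ξ) :
    TangentSpace (cotModel E) ξ :=
  ofHorVert g ξ ((flat g ξ.proj).symm (verticalPart g ξ z)) (-flat g ξ.proj (dproj ξ z))

/-- The almost complex structure is compatible with the symplectic form: `ω(z, Jw)` is the inner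
product `⟨Kz, Kw⟩ + ⟨dπ z, dπ w⟩` of the vertical and horizontal parts. -/
theorem symplecticForm_almostComplex (g : Metric E M) (ξ : CotangentBundle E M)
    (z w : TangentSpace (cotModel E) ξ) :
    symplecticForm ξ z (almostComplex g ξ w) =
      g.inner ξ.proj ((flat g ξ.proj).symm (verticalPart g ξ z))
        ((flat g ξ.proj).symm (verticalPart g ξ w)) +
      g.inner ξ.proj (dproj ξ z) (dproj ξ w) := by
  have hs : ∀ a b : E, connectionTerm g ξ a b = connectionTerm g ξ b a := by
    intro a b
    have h := metricDeriv_symm g ξ.proj ((flat g ξ.proj).symm (covector ξ)) a b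
    have h1 := connectionTerm_apply g ξ a b
    have h2 := connectionTerm_apply g ξ b a
    linarith
  have hω : ∀ z w : TangentSpace (cotModel E) ξ,
      symplecticForm ξ z w = verticalPart g ξ z w.1 - verticalPart g ξ w z.1 := by
    intro z w
    have h := hs z.1 w.1
    have h1 := symplecticForm_apply ξ z w
    have h2 : verticalPart g ξ z w.1 = z.2 w.1 - connectionTerm g ξ z.1 w.1 := rfl
    have h3 : verticalPart g ξ w z.1 = w.2 z.1 - connectionTerm g ξ w.1 z.1 := rfl
    linarith
  have hJ : verticalPart g ξ (almostComplex g ξ w) = -g.inner ξ.proj (dproj ξ w) :=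
    add_sub_cancel_right (G := E →L[ℝ] ℝ) _ _
  have hz : g.inner ξ.proj ((flat g ξ.proj).symm (verticalPart g ξ z)) = verticalPart g ξ z :=
    (flat g ξ.proj).apply_symm_apply _
  rw [hω, hJ, hz, dproj_apply ξ z, g.symm ξ.proj z.1]
  exact sub_neg_eq_add _ _

/-- The Hamiltonian `ξ ↦ ξ(∇A)`. -/
def liftHamiltonian (g : Metric E M) (A : M → ℝ) (ξ : CotangentBundle E M) : ℝ :=
  covector ξ (grad g A ξ.proj)

/-- A function is Morse if its Hessian is nondegenerate at every critical point. -/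
def IsMorse (A : M → ℝ) : Prop :=
  ∀ x : M, mfderiv 𝓘(ℝ, E) 𝓘(ℝ, ℝ) A x = 0 →
    ∀ a : E, (∀ b : E, fderiv ℝ (fderiv ℝ (A ∘ (extChartAt 𝓘(ℝ, E) x).symm))
      (extChartAt 𝓘(ℝ, E) x x) a b = 0) → a = 0

/-- A critical point of a function on the cotangent bundle. -/
def IsCritical (H : CotangentBundle E M → ℝ) (ξ : CotangentBundle E M) : Prop :=
  dfun H ξ = 0

/-- The strip `ℝ × [0, 1]`, with coordinates `(t, τ)`. -/
def strip : Set (ℝ × ℝ) := Set.univ ×ˢ Set.Icc 0 1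

/-- The partial derivative `∂ₜu` of a map on the strip. -/
def partialT (u : ℝ × ℝ → CotangentBundle E M) (p : ℝ × ℝ) : TangentSpace (cotModel E) (u p) :=
  mfderivWithin 𝓘(ℝ, ℝ × ℝ) (cotModel E) u strip p ((1, 0) : ℝ × ℝ)

/-- The partial derivative `∂_τ u` of a map on the strip. -/
def partialTau (u : ℝ × ℝ → CotangentBundle E M) (p : ℝ × ℝ) : TangentSpace (cotModel E) (u p) :=
  mfderivWithin 𝓘(ℝ, ℝ × ℝ) (cotModel E) u strip p ((0, 1) : ℝ × ℝ)

/-- `u : ℝ × [0, 1] → T*M` (extended arbitrarily to `ℝ × ℝ`) is a solution of the Floer equation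
`∂ₜu + J(u) ∂_τ u + X_H(u) = 0` with boundary on the zero section, converging to critical points
of `H` as `t → ±∞`, uniformly in `τ`. -/
structure IsFloerStrip (g : Metric E M) (H : CotangentBundle E M → ℝ)
    (u : ℝ × ℝ → CotangentBundle E M) : Prop where
  contMDiffOn : ContMDiffOn 𝓘(ℝ, ℝ × ℝ) (cotModel E) 2 u strip
  equation : ∀ p ∈ strip,
    partialT u p + almostComplex g (u p) (partialTau u p) + hamiltonianVectorField H (u p) = 0
  boundary_zero : ∀ t : ℝ, covector (u (t, 0)) = 0
  boundary_one : ∀ t : ℝ, covector (u (t, 1)) = 0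
  tendsto_atBot : ∃ ξ, IsCritical H ξ ∧
    Filter.Tendsto u (Filter.atBot ×ˢ Filter.principal (Set.Icc 0 1)) (𝓝 ξ)
  tendsto_atTop : ∃ ξ, IsCritical H ξ ∧
    Filter.Tendsto u (Filter.atTop ×ˢ Filter.principal (Set.Icc 0 1)) (𝓝 ξ)

/-- `v : ℝ → M` is a (negative) gradient trajectory of `A`, `v' + ∇A(v) = 0`, converging to critical
points of `A` as `t → ±∞`. -/
structure IsGradientTrajectory (g : Metric E M) (A : M → ℝ) (v : ℝ → M) : Prop where
  equation : IsMIntegralCurve (I := 𝓘(ℝ, E)) v (fun x => -grad g A x)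
  tendsto_atBot : ∃ x, mfderiv 𝓘(ℝ, E) 𝓘(ℝ, ℝ) A x = 0 ∧ Filter.Tendsto v Filter.atBot (𝓝 x)
  tendsto_atTop : ∃ x, mfderiv 𝓘(ℝ, E) 𝓘(ℝ, ℝ) A x = 0 ∧ Filter.Tendsto v Filter.atTop (𝓝 x)

variable (E) in
/-- The zero section of the cotangent bundle. -/
def zeroCovector (x : M) : CotangentBundle E M := ⟨x, 0⟩

end CotangentFloer
end

/-! The proof is an energy argument using only uniform bounds on `u` at the ends, with no decay of
its derivatives. Put `f = λ(∂_τ u)` and `k = λ(∂ₜu) + H(u)`, where `H(ξ) = ξ(∇A)`. Naturality of `d`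
and the Floer equation give `∂ₜf - ∂_τ k = ω(∂ₜu, ∂_τ u) - dH(∂_τ u) = ω(∂_τ u, J ∂_τ u) = |∂_τ u|²`
(`stripCurl_eq_energy`). Both `λ` and `H` vanish on the zero section, so `k = 0` on the boundary of
the strip. By Green's formula, `a(t) = ∫₀¹ f(t, τ) dτ` has derivative `∫₀¹ |∂_τ u|² dτ ≥ 0`.

Since `f` is the covector `u` evaluated on `dπ(∂_τ u)`, Cauchy-Schwarz gives `f² ≤ |u|² |∂_τ u|²`.
Convergence of `u` bounds the fibre norm `|u|` for large `|t|` (`exists_pullbackForm_sq_le`), hence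
`a² ≤ C a'` there. A positive value of `a` would then blow up in finite forward time, a negative one
in finite backward time (`nonpos_of_sq_growth`). Therefore `a = 0`, the energy vanishes, and `∂_τ u
= 0` (`stripCurl_eq_zero`, `IsFloerStrip.partialTau_eq_zero`).

Now `u(t, τ) = u(t, 0)` lies in the zero section and the equation reads `∂ₜu = -X_H(u)`. The
projection of `X_H` to the base is `∇A`, which gives the gradient trajectory. For the converse, `X_H
= (∇A, 0)` along the zero section, and gradient trajectories are smooth by bootstrapping. -/

noncomputable section

namespace CotangentFloer

/-! ### Canonical coordinates: frames, covectors and the metric -/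

section Coordinates

variable {E : Type*} [NormedAddCommGroup E] [NormedSpace ℝ E]
  {M : Type*} [TopologicalSpace M] [ChartedSpace E M] [IsManifold 𝓘(ℝ, E) ∞ M]

/-- The coordinate frame of the preferred chart at `x`, at the point with coordinates `e`. -/
def chartFrame (x : M) (e : E) : E →L[ℝ] E :=
  mfderiv 𝓘(ℝ, E) 𝓘(ℝ, E) (extChartAt 𝓘(ℝ, E) x).symm e

theorem chartFrame_eq_symmL {x y : M} (hy : y ∈ (chartAt E x).source) :
    chartFrame x (extChartAt 𝓘(ℝ, E) x y) =
      Bundle.Trivialization.symmL ℝ (trivializationAt E (TangentSpace 𝓘(ℝ, E)) x) y := by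
  have h := TangentBundle.symmL_trivializationAt (I := 𝓘(ℝ, E)) (x₀ := x) (x := y) hy
  rw [ModelWithCorners.range_eq_univ, mfderivWithin_univ] at h
  exact h.symm

theorem isInvertible_chartFrame {x : M} {e : E} (he : e ∈ (extChartAt 𝓘(ℝ, E) x).target) :
    (chartFrame x e).IsInvertible := by
  have h := isInvertible_mfderivWithin_extChartAt_symm (I := 𝓘(ℝ, E)) he
  rw [ModelWithCorners.range_eq_univ, mfderivWithin_univ] at h
  exact h

theorem chartFrame_self (x : M) :
    chartFrame x (extChartAt 𝓘(ℝ, E) x x) = ContinuousLinearMap.id ℝ E := by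
  have h := mfderivWithin_range_extChartAt_symm (I := 𝓘(ℝ, E)) (x := x)
  rw [ModelWithCorners.range_eq_univ, mfderivWithin_univ] at h
  exact h

theorem mdifferentiableAt_extChartAt_symm {x : M} {e : E}
    (he : e ∈ (extChartAt 𝓘(ℝ, E) x).target) :
    MDifferentiableAt 𝓘(ℝ, E) 𝓘(ℝ, E) (extChartAt 𝓘(ℝ, E) x).symm e := by
  have := mdifferentiableWithinAt_extChartAt_symm (I := 𝓘(ℝ, E)) he
  rwa [ModelWithCorners.range_eq_univ, mdifferentiableWithinAt_univ] at this

theorem fst_mem_extChartAt_target {ξ : CotangentBundle E M} {e : E × (E →L[ℝ] ℝ)}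
    (he : e ∈ (extChartAt (cotModel E) ξ).target) : e.1 ∈ (extChartAt 𝓘(ℝ, E) ξ.proj).target := by
  rw [FiberBundle.extChartAt_target] at he
  exact he.1.1

/-- The fibre coordinate of the Hom bundle is precomposition with the inverse of the tangent
trivialization, and by `chartFrame_eq_symmL` that inverse is the coordinate frame. -/
theorem covector_chartFrame {ξ : CotangentBundle E M} {e : E × (E →L[ℝ] ℝ)}
    (he : e ∈ (extChartAt (cotModel E) ξ).target) (w : E) :
    covector ((extChartAt (cotModel E) ξ).symm e) (chartFrame ξ.proj e.1 w) = e.2 w := by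
  obtain ⟨hsrc, hpe⟩ := proj_extChartAt_symm ξ e he
  have hr : extChartAt (cotModel E) ξ ((extChartAt (cotModel E) ξ).symm e) = e :=
    (extChartAt (cotModel E) ξ).right_inv he
  set η := (extChartAt (cotModel E) ξ).symm e with hη
  have hq : extChartAt 𝓘(ℝ, E) ξ.proj η.proj = e.1 := by rw [← hr]; rfl
  have h7 : ContinuousLinearMap.inCoordinates E (TangentSpace 𝓘(ℝ, E)) ℝ (Bundle.Trivial M ℝ)
      ξ.proj η.proj ξ.proj η.proj η.snd = e.2 := by
    rw [← hr]; rfl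
  have h8 := chartFrame_eq_symmL hsrc
  rw [hq] at h8
  have h9 : ContinuousLinearMap.inCoordinates E (TangentSpace 𝓘(ℝ, E)) ℝ (Bundle.Trivial M ℝ)
      ξ.proj η.proj ξ.proj η.proj η.snd w = η.snd (Bundle.Trivialization.symmL ℝ
        (trivializationAt E (TangentSpace 𝓘(ℝ, E)) ξ.proj) η.proj w) := by
    simp [ContinuousLinearMap.inCoordinates]
  rw [h8, ← h7]
  exact h9.symm

theorem extChartAt_self_snd (ξ : CotangentBundle E M) :
    (extChartAt (cotModel E) ξ ξ).2 = covector ξ := by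
  refine ContinuousLinearMap.ext fun w => ?_
  have h := covector_chartFrame (mem_extChartAt_target (I := cotModel E) ξ) w
  have h1 : chartFrame ξ.proj (extChartAt (cotModel E) ξ ξ).1 w = w :=
    congrArg (fun T : E →L[ℝ] E => T w) (chartFrame_self ξ.proj)
  rw [h1, extChartAt_to_inv] at h
  exact h.symm

theorem metricInChart_apply (g : Metric E M) (x : M) (e v w : E) :
    metricInChart g x e v w = g.inner ((extChartAt 𝓘(ℝ, E) x).symm e) (chartFrame x e v)
      (chartFrame x e w) := rfl

/-- Smoothness of `g` is given as smoothness of a bundle section. Its expression in the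
trivializations is the matrix of the metric, because trivializations and coordinate frames agree. -/
theorem contDiffAt_metricInChart (g : Metric E M) (x : M) :
    ContDiffAt ℝ ∞ (metricInChart g x) (extChartAt 𝓘(ℝ, E) x x) := by
  have h := (Bundle.contMDiffAt_section x).1 (g.contMDiff x)
  have h2 := h.comp_of_eq (contMDiffOn_extChartAt_symm (I := 𝓘(ℝ, E)) (n := ∞) x |>.contMDiffAt
    (extChartAt_target_mem_nhds (I := 𝓘(ℝ, E)) x)) (extChartAt_to_inv x)
  rw [contMDiffAt_iff_contDiffAt] at h2
  refine h2.congr_of_eventuallyEq ?_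
  filter_upwards [extChartAt_target_mem_nhds (I := 𝓘(ℝ, E)) x] with e he
  have hy := (extChartAt 𝓘(ℝ, E) x).map_target he
  rw [extChartAt_source] at hy
  have hf := chartFrame_eq_symmL hy
  rw [(extChartAt 𝓘(ℝ, E) x).right_inv he] at hf
  refine ContinuousLinearMap.ext fun v => ContinuousLinearMap.ext fun w => ?_
  have h3 := inCoordinates_apply_eq₂ (F₁ := E) (E₁ := (TangentSpace 𝓘(ℝ, E) : M → Type _)) (F₂ := E)
    (E₂ := (TangentSpace 𝓘(ℝ, E) : M → Type _)) (F₃ := ℝ) (E₃ := Bundle.Trivial M ℝ)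
    (ϕ := g.inner ((extChartAt 𝓘(ℝ, E) x).symm e)) (v := v) (w := w)
    (x₀ := x) (x := (extChartAt 𝓘(ℝ, E) x).symm e) hy hy (Set.mem_univ _)
  refine Eq.trans ?_ h3.symm
  have hs : ∀ a : E, chartFrame x e a = (trivializationAt E (TangentSpace 𝓘(ℝ, E)) x).symm
      ((extChartAt 𝓘(ℝ, E) x).symm e) a := fun a =>
    (congrArg (fun T : E →L[ℝ] E => T a) hf).trans (Bundle.Trivialization.symmL_apply _ hy a)
  rw [metricInChart_apply, hs, hs]
  simp

variable [FiniteDimensional ℝ E]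

theorem isInvertible_metricInChart (g : Metric E M) {x : M} {e : E}
    (he : e ∈ (extChartAt 𝓘(ℝ, E) x).target) : (metricInChart g x e).IsInvertible := by
  obtain ⟨P, hP⟩ := isInvertible_chartFrame he
  have hinj : Function.Injective (metricInChart g x e) := by
    rw [← ContinuousLinearMap.coe_coe, ← LinearMap.ker_eq_bot, LinearMap.ker_eq_bot']
    intro v hv
    by_contra h0
    have h1 : chartFrame x e v ≠ 0 := by
      rw [← hP]; simpa using h0
    have h2 : metricInChart g x e v v = 0 := congrArg (fun T : E →L[ℝ] ℝ => T v) hv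
    exact (g.pos ((extChartAt 𝓘(ℝ, E) x).symm e) (chartFrame x e v) h1).ne' h2
  have hr : Module.finrank ℝ E = Module.finrank ℝ (E →L[ℝ] ℝ) :=
    (Subspace.dual_finrank_eq (K := ℝ) (V := E)).symm.trans
      (LinearEquiv.finrank_eq LinearMap.toContinuousLinearMap)
  let L : E ≃ₗ[ℝ] (E →L[ℝ] ℝ) := LinearEquiv.ofBijective (metricInChart g x e).toLinearMap
    ⟨hinj, (LinearMap.injective_iff_surjective_of_finrank_eq_finrank hr).1 hinj⟩
  exact ⟨L.toContinuousLinearEquiv, by ext; rfl⟩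

theorem contDiffAt_inverse_metricInChart (g : Metric E M) (x : M) :
    ContDiffAt ℝ ∞ (fun e => (metricInChart g x e).inverse) (extChartAt 𝓘(ℝ, E) x x) :=
  (isInvertible_metricInChart g (mem_extChartAt_target x)).contDiffAt_map_inverse.comp _
    (contDiffAt_metricInChart g x)

theorem inner_flat_symm (g : Metric E M) (x : M) (θ : TangentSpace 𝓘(ℝ, E) x →L[ℝ] ℝ)
    (b : TangentSpace 𝓘(ℝ, E) x) : g.inner x ((flat g x).symm θ) b = θ b :=
  congrArg (fun T : TangentSpace 𝓘(ℝ, E) x →L[ℝ] ℝ => T b) ((flat g x).apply_symm_apply θ)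

/-- Raising an index in coordinates. -/
theorem chartFrame_inverse_metricInChart (g : Metric E M) {x y : M} {e : E}
    (he : e ∈ (extChartAt 𝓘(ℝ, E) x).target) (hy : y = (extChartAt 𝓘(ℝ, E) x).symm e)
    (θ : TangentSpace 𝓘(ℝ, E) y →L[ℝ] ℝ) (θ' : E →L[ℝ] ℝ)
    (hθ : ∀ w, θ (chartFrame x e w) = θ' w) :
    chartFrame x e ((metricInChart g x e).inverse θ') = (flat g y).symm θ := by
  subst hy
  obtain ⟨P, hP⟩ := isInvertible_chartFrame he
  refine (LinearEquiv.eq_symm_apply (flat g ((extChartAt 𝓘(ℝ, E) x).symm e))).2 ?_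
  refine ContinuousLinearMap.ext fun b => ?_
  obtain ⟨w, rfl⟩ : ∃ w, chartFrame x e w = b := ⟨P.symm b, by rw [← hP]; exact P.apply_symm_apply b⟩
  have h1 : metricInChart g x e ((metricInChart g x e).inverse θ') = θ' := by
    obtain ⟨G, hG⟩ := isInvertible_metricInChart g he
    rw [← hG]; simp
  refine Eq.trans ?_ (hθ w).symm
  exact congrArg (fun T : E →L[ℝ] ℝ => T w) h1

/-- The pairing `gⁱʲ pᵢ θⱼ` in coordinates. With `θ = dA` it expresses the Hamiltonian, and with `θ`
the covector itself it expresses the squared fibre norm. -/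
theorem covector_flat_symm (g : Metric E M) {ξ η : CotangentBundle E M} {e : E × (E →L[ℝ] ℝ)}
    (he : e ∈ (extChartAt (cotModel E) ξ).target) (hη : η = (extChartAt (cotModel E) ξ).symm e)
    (θ : TangentSpace 𝓘(ℝ, E) η.proj →L[ℝ] ℝ) (θ' : E →L[ℝ] ℝ)
    (hθ : ∀ w, θ (chartFrame ξ.proj e.1 w) = θ' w) :
    covector η ((flat g η.proj).symm θ) = e.2 ((metricInChart g ξ.proj e.1).inverse θ') := by
  subst hη
  rw [← covector_chartFrame he, chartFrame_inverse_metricInChart g (fst_mem_extChartAt_target he)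
    (proj_extChartAt_symm ξ e he).2 θ θ' hθ]

end Coordinates

/-! ### The Hamiltonian and its vector field in coordinates -/

section Hamiltonian

variable {E : Type*} [NormedAddCommGroup E] [NormedSpace ℝ E] [FiniteDimensional ℝ E]
  {M : Type*} [TopologicalSpace M] [ChartedSpace E M] [IsManifold 𝓘(ℝ, E) ∞ M]

/-- The gradient of `A` in the preferred chart at `x`. -/
def gradInChart (g : Metric E M) (A : M → ℝ) (x : M) (e : E) : E :=
  (metricInChart g x e).inverse (fderiv ℝ (A ∘ (extChartAt 𝓘(ℝ, E) x).symm) e)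

variable (g : Metric E M) {A : M → ℝ} (hA : ContMDiff 𝓘(ℝ, E) 𝓘(ℝ, ℝ) ∞ A)
include hA

theorem contDiffAt_gradInChart (x : M) :
    ContDiffAt ℝ ∞ (gradInChart g A x) (extChartAt 𝓘(ℝ, E) x x) := by
  have h : ContDiffAt ℝ ∞ (A ∘ (extChartAt 𝓘(ℝ, E) x).symm) (extChartAt 𝓘(ℝ, E) x x) :=
    (hA.contMDiffAt.comp _ (contMDiffOn_extChartAt_symm (I := 𝓘(ℝ, E)) (n := ∞) x |>.contMDiffAt
      (extChartAt_target_mem_nhds (I := 𝓘(ℝ, E)) x))).contDiffAt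
  exact (contDiffAt_inverse_metricInChart g x).clm_apply (h.fderiv_right (m := ∞) le_rfl)

omit [FiniteDimensional ℝ E] in
theorem mfderiv_chartFrame {x y : M} {e : E} (he : e ∈ (extChartAt 𝓘(ℝ, E) x).target)
    (hy : y = (extChartAt 𝓘(ℝ, E) x).symm e) (w : E) :
    mfderiv 𝓘(ℝ, E) 𝓘(ℝ, ℝ) A y (chartFrame x e w) =
      fderiv ℝ (A ∘ (extChartAt 𝓘(ℝ, E) x).symm) e w := by
  subst hy
  rw [← mfderiv_eq_fderiv]
  exact (mfderiv_comp_apply e ((hA.mdifferentiable (by simp)) _)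
    (mdifferentiableAt_extChartAt_symm he) w).symm

theorem chartFrame_gradInChart {x : M} {e : E} (he : e ∈ (extChartAt 𝓘(ℝ, E) x).target) :
    chartFrame x e (gradInChart g A x e) = grad g A ((extChartAt 𝓘(ℝ, E) x).symm e) :=
  chartFrame_inverse_metricInChart g he rfl _ _ (mfderiv_chartFrame hA he rfl)

theorem gradInChart_self (x : M) : gradInChart g A x (extChartAt 𝓘(ℝ, E) x x) = grad g A x := by
  have h := chartFrame_gradInChart g hA (mem_extChartAt_target (I := 𝓘(ℝ, E)) x)
  rw [chartFrame_self, extChartAt_to_inv] at h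
  exact h

theorem liftHamiltonian_comp_extChartAt_symm {ξ : CotangentBundle E M} {e : E × (E →L[ℝ] ℝ)}
    (he : e ∈ (extChartAt (cotModel E) ξ).target) :
    liftHamiltonian g A ((extChartAt (cotModel E) ξ).symm e) = e.2 (gradInChart g A ξ.proj e.1) :=
  covector_flat_symm g he rfl _ _
    (mfderiv_chartFrame hA (fst_mem_extChartAt_target he) (proj_extChartAt_symm ξ e he).2)

theorem liftHamiltonian_eventuallyEq (ξ : CotangentBundle E M) :
    liftHamiltonian g A ∘ (extChartAt (cotModel E) ξ).symm =ᶠ[𝓝 (extChartAt (cotModel E) ξ ξ)]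
      fun e => e.2 (gradInChart g A ξ.proj e.1) := by
  filter_upwards [extChartAt_target_mem_nhds (I := cotModel E) ξ] with e he
  exact liftHamiltonian_comp_extChartAt_symm g hA he

theorem contDiffAt_liftHamiltonianInChart (ξ : CotangentBundle E M) :
    ContDiffAt ℝ ∞ (fun e : E × (E →L[ℝ] ℝ) => e.2 (gradInChart g A ξ.proj e.1))
      (extChartAt (cotModel E) ξ ξ) :=
  contDiffAt_snd.clm_apply ((contDiffAt_gradInChart g hA ξ.proj).comp
    (extChartAt (cotModel E) ξ ξ) contDiffAt_fst)

theorem contMDiff_liftHamiltonian :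
    ContMDiff (cotModel E) 𝓘(ℝ, ℝ) ∞ (liftHamiltonian g A) := by
  intro ξ
  rw [contMDiffAt_iff_source, ModelWithCorners.range_eq_univ, contMDiffWithinAt_univ]
  exact ((contDiffAt_liftHamiltonianInChart g hA ξ).congr_of_eventuallyEq
    (liftHamiltonian_eventuallyEq g hA ξ)).contMDiffAt

/-- Product rule for `H(q, p) = p(G(q))`, with `G` the gradient in the chart. -/
theorem dfun_liftHamiltonian (ξ : CotangentBundle E M) (w : E × (E →L[ℝ] ℝ)) :
    dfun (liftHamiltonian g A) ξ w =
      w.2 (gradInChart g A ξ.proj (extChartAt 𝓘(ℝ, E) ξ.proj ξ.proj)) +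
      (extChartAt (cotModel E) ξ ξ).2 (fderiv ℝ (gradInChart g A ξ.proj) (extChartAt 𝓘(ℝ, E) ξ.proj ξ.proj) w.1) := by
  have hm := (contMDiff_liftHamiltonian g hA ξ).mdifferentiableAt (by simp)
  have h1 : dfun (liftHamiltonian g A) ξ =
      fderiv ℝ (liftHamiltonian g A ∘ (extChartAt (cotModel E) ξ).symm)
        (extChartAt (cotModel E) ξ ξ) := by
    unfold dfun
    rw [hm.mfderiv, ModelWithCorners.range_eq_univ, fderivWithin_univ]
    rfl
  rw [(liftHamiltonian_eventuallyEq g hA ξ).fderiv_eq] at h1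
  have h2 := ((contDiffAt_gradInChart g hA ξ.proj).differentiableAt (by simp)).hasFDerivAt
  have h3 := HasFDerivAt.comp (f := Prod.fst) (extChartAt (cotModel E) ξ ξ) h2
    (hasFDerivAt_fst (𝕜 := ℝ))
  have h4 := (hasFDerivAt_snd (𝕜 := ℝ) (p := extChartAt (cotModel E) ξ ξ)).clm_apply h3
  have h5 := h1.trans h4.fderiv
  refine (congrArg (fun T : E × (E →L[ℝ] ℝ) →L[ℝ] ℝ => T w) h5).trans ?_
  exact add_comm _ _

theorem hamiltonianVectorField_apply (ξ : CotangentBundle E M) (w : E × (E →L[ℝ] ℝ)) :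
    w.2 (hamiltonianVectorField (liftHamiltonian g A) ξ).1 -
      (hamiltonianVectorField (liftHamiltonian g A) ξ).2 w.1 =
      w.2 (gradInChart g A ξ.proj (extChartAt 𝓘(ℝ, E) ξ.proj ξ.proj)) +
        (extChartAt (cotModel E) ξ ξ).2 (fderiv ℝ (gradInChart g A ξ.proj) (extChartAt 𝓘(ℝ, E) ξ.proj ξ.proj) w.1) :=
  (symplecticForm_apply ξ _ _).symm.trans
    ((symplecticForm_hamiltonianVectorField _ ξ _).trans (dfun_liftHamiltonian g hA ξ w))

/-- Testing `ω(·, X_H) = dH` on the vectors `(0, β)` isolates the base component, and the derivative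
of `G` does not enter. -/
theorem hamiltonianVectorField_fst (ξ : CotangentBundle E M) :
    (hamiltonianVectorField (liftHamiltonian g A) ξ).1 = grad g A ξ.proj := by
  refine Eq.trans ?_ (gradInChart_self g hA ξ.proj)
  refine (SeparatingDual.eq_iff_forall_dual_eq (R := ℝ) (V := E)).2 fun β => ?_
  have h := hamiltonianVectorField_apply g hA ξ (0, β)
  simpa only [map_zero, sub_zero, add_zero] using h

/-- Testing on `(a, 0)` leaves the term `p(DG(a))`, which vanishes for `p = 0`. -/
theorem hamiltonianVectorField_snd {ξ : CotangentBundle E M} (hξ : covector ξ = 0) :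
    (hamiltonianVectorField (liftHamiltonian g A) ξ).2 = 0 := by
  refine ContinuousLinearMap.ext fun a => ?_
  have h := hamiltonianVectorField_apply g hA ξ (a, 0)
  have h0 : (extChartAt (cotModel E) ξ ξ).2 = 0 := (extChartAt_self_snd ξ).trans hξ
  rw [h0] at h
  simpa only [zero_apply, zero_sub, add_zero, neg_eq_zero] using h

omit hA in
theorem grad_eq_zero_iff (x : M) : grad g A x = 0 ↔ mfderiv 𝓘(ℝ, E) 𝓘(ℝ, ℝ) A x = 0 :=
  (flat g x).symm.map_eq_zero_iff

theorem isCritical_liftHamiltonian_iff {ξ : CotangentBundle E M} (hξ : covector ξ = 0) :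
    IsCritical (liftHamiltonian g A) ξ ↔ mfderiv 𝓘(ℝ, E) 𝓘(ℝ, ℝ) A ξ.proj = 0 := by
  have h0 : (extChartAt (cotModel E) ξ ξ).2 = 0 := (extChartAt_self_snd ξ).trans hξ
  have hg := gradInChart_self g hA ξ.proj
  rw [← grad_eq_zero_iff g]
  constructor
  · intro h
    refine hg.symm.trans ?_
    refine (SeparatingDual.eq_iff_forall_dual_eq (R := ℝ) (V := E)).2 fun β => ?_
    have h1 := dfun_liftHamiltonian g hA ξ (0, β)
    have h2 : dfun (liftHamiltonian g A) ξ ((0, β) : E × (E →L[ℝ] ℝ)) = 0 :=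
      congrArg (fun T : E × (E →L[ℝ] ℝ) →L[ℝ] ℝ => T (0, β)) h
    rw [h2, h0] at h1
    simp only [zero_apply, add_zero] at h1
    exact h1.symm.trans (map_zero β).symm
  · intro h
    refine ContinuousLinearMap.ext fun w => ?_
    have h1 := dfun_liftHamiltonian g hA ξ w
    rw [h0, hg.trans h] at h1
    exact h1.trans ((add_zero _).trans (map_zero (w.2 : E →L[ℝ] ℝ)))

omit hA in
/-- The squared norm of covectors is locally bounded. -/
theorem eventually_covector_flat_symm_le (ξ : CotangentBundle E M) :
    ∃ C : ℝ, ∀ᶠ η in 𝓝 ξ, covector η ((flat g η.proj).symm (covector η)) ≤ C := by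
  let N : E × (E →L[ℝ] ℝ) → ℝ := fun e => e.2 ((metricInChart g ξ.proj e.1).inverse e.2)
  have hN : ContinuousAt N (extChartAt (cotModel E) ξ ξ) :=
    ContDiffAt.continuousAt (𝕜 := ℝ) (n := ∞) (contDiffAt_snd.clm_apply
      (((contDiffAt_inverse_metricInChart g ξ.proj).comp (extChartAt (cotModel E) ξ ξ)
        contDiffAt_fst).clm_apply contDiffAt_snd))
  have h1 : ContinuousAt (N ∘ extChartAt (cotModel E) ξ) ξ :=
    ContinuousAt.comp hN (continuousAt_extChartAt ξ)
  refine ⟨N (extChartAt (cotModel E) ξ ξ) + 1, ?_⟩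
  filter_upwards [h1.eventually (gt_mem_nhds (lt_add_one _)),
    extChartAt_source_mem_nhds (I := cotModel E) ξ] with η hη hs
  have he := (extChartAt (cotModel E) ξ).map_source hs
  have hη' := (extChartAt (cotModel E) ξ).left_inv hs
  have h2 : covector η ((flat g η.proj).symm (covector η)) = N (extChartAt (cotModel E) ξ η) :=
    covector_flat_symm g he hη'.symm _ _ fun w => by
      have h3 := covector_chartFrame he w
      rwa [hη'] at h3
  exact h2.le.trans hη.le

end Hamiltonian

/-! ### Pulling back the tautological form to the strip -/

section Strip

theorem convex_strip : Convex ℝ strip := convex_univ.prod (convex_Icc 0 1)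

theorem interior_strip : interior strip = Set.univ ×ˢ Set.Ioo (0 : ℝ) 1 := by
  rw [strip, interior_prod_eq, interior_univ, interior_Icc]

theorem mem_strip {t τ : ℝ} : (t, τ) ∈ strip ↔ τ ∈ Set.Icc (0 : ℝ) 1 := by simp [strip]

theorem nonempty_interior_strip : (interior strip).Nonempty := by
  rw [interior_strip]; exact ⟨(0, 1 / 2), by norm_num⟩

theorem uniqueDiffOn_strip : UniqueDiffOn ℝ strip :=
  uniqueDiffOn_convex convex_strip nonempty_interior_strip

theorem strip_subset_closure_interior : strip ⊆ closure (interior strip) := by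
  rw [convex_strip.closure_interior_eq_closure_of_nonempty_interior nonempty_interior_strip]
  exact subset_closure

variable {E : Type*} [NormedAddCommGroup E] [NormedSpace ℝ E]
  {M : Type*} [TopologicalSpace M] [ChartedSpace E M] [IsManifold 𝓘(ℝ, E) ∞ M]

theorem tautologicalForm_mfderiv_extChartAt_symm (ξ : CotangentBundle E M) :
    ∀ᶠ e in 𝓝 (extChartAt (cotModel E) ξ ξ), ∀ η : CotangentBundle E M,
      η = (extChartAt (cotModel E) ξ).symm e → ∀ w : E × (E →L[ℝ] ℝ),
        tautologicalForm η (mfderiv 𝓘(ℝ, E × (E →L[ℝ] ℝ)) (cotModel E)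
          (extChartAt (cotModel E) ξ).symm e w) = e.2 w.1 := by
  filter_upwards [oneFormInChart_tautologicalForm ξ] with e he η hη w
  subst hη
  exact congrArg (fun T : E × (E →L[ℝ] ℝ) →L[ℝ] ℝ => T w) he

/-- The value on a constant vector field of the pull-back of the tautological form. -/
def pullbackForm (u : ℝ × ℝ → CotangentBundle E M) (w p : ℝ × ℝ) : ℝ :=
  tautologicalForm (u p) (mfderivWithin 𝓘(ℝ, ℝ × ℝ) (cotModel E) u strip p w)

variable {u : ℝ × ℝ → CotangentBundle E M}
  (hu : ContMDiffOn 𝓘(ℝ, ℝ × ℝ) (cotModel E) 2 u strip)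
include hu

theorem contDiffWithinAt_extChartAt_comp {p : ℝ × ℝ} (hp : p ∈ strip) :
    ContDiffWithinAt ℝ 2 (extChartAt (cotModel E) (u p) ∘ u) strip p :=
  (contMDiffWithinAt_iff_target.1 (hu p hp)).2.contDiffWithinAt

theorem mdifferentiableWithinAt_strip {p : ℝ × ℝ} (hp : p ∈ strip) :
    MDifferentiableWithinAt 𝓘(ℝ, ℝ × ℝ) (cotModel E) u strip p :=
  (hu p hp).mdifferentiableWithinAt (by simp)

theorem mfderivWithin_eq_fderivWithin_extChartAt_comp {p : ℝ × ℝ} (hp : p ∈ strip) :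
    mfderivWithin 𝓘(ℝ, ℝ × ℝ) (cotModel E) u strip p =
      fderivWithin ℝ (extChartAt (cotModel E) (u p) ∘ u) strip p := by
  rw [(mdifferentiableWithinAt_strip hu hp).mfderivWithin]
  simp only [writtenInExtChartAt, extChartAt_model_space_eq_id, modelWithCornersSelf_coe,
    Set.range_id, Set.inter_univ]
  rfl

/-- Chain rule for `u = φ⁻¹ ∘ (φ ∘ u)` near `q`, where `φ` stays the chart at `u p`. A fixed chart
is needed since `mfderivWithin` at `q` refers to the chart at `u q`, which varies with `q` and
cannot be differentiated through. -/
theorem mfderivWithin_eq_comp {p q : ℝ × ℝ} (hq : q ∈ strip)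
    (hs : u q ∈ (extChartAt (cotModel E) (u p)).source)
    (hd : DifferentiableWithinAt ℝ (extChartAt (cotModel E) (u p) ∘ u) strip q) (w : ℝ × ℝ) :
    (mfderivWithin 𝓘(ℝ, ℝ × ℝ) (cotModel E) u strip q w : E × (E →L[ℝ] ℝ)) =
      mfderiv 𝓘(ℝ, E × (E →L[ℝ] ℝ)) (cotModel E) (extChartAt (cotModel E) (u p)).symm
        (extChartAt (cotModel E) (u p) (u q))
        (fderivWithin ℝ (extChartAt (cotModel E) (u p) ∘ u) strip q w) := by
  have hm : MDifferentiableAt 𝓘(ℝ, E × (E →L[ℝ] ℝ)) (cotModel E)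
      (extChartAt (cotModel E) (u p)).symm (extChartAt (cotModel E) (u p) (u q)) := by
    have := mdifferentiableWithinAt_extChartAt_symm (I := cotModel E)
      ((extChartAt (cotModel E) (u p)).map_source hs)
    rwa [ModelWithCorners.range_eq_univ, mdifferentiableWithinAt_univ] at this
  have hU : UniqueMDiffWithinAt 𝓘(ℝ, ℝ × ℝ) strip q :=
    (uniqueDiffOn_strip q hq).uniqueMDiffWithinAt
  have h1 := mfderiv_comp_mfderivWithin (I := 𝓘(ℝ, ℝ × ℝ)) q hm hd.mdifferentiableWithinAt hU
  have hev : (extChartAt (cotModel E) (u p)).symm ∘ (extChartAt (cotModel E) (u p) ∘ u)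
      =ᶠ[𝓝[strip] q] u := by
    filter_upwards [(hu q hq).continuousWithinAt.preimage_mem_nhdsWithin
      ((isOpen_extChartAt_source (u p)).mem_nhds hs)] with q' hq'
    exact (extChartAt (cotModel E) (u p)).left_inv hq'
  have h2 := hev.mfderivWithin_eq (I := 𝓘(ℝ, ℝ × ℝ)) (I' := cotModel E)
    ((extChartAt (cotModel E) (u p)).left_inv hs)
  have h3 := congrArg (fun T : ℝ × ℝ →L[ℝ] E × (E →L[ℝ] ℝ) => T w) (h2.symm.trans h1)
  refine h3.trans ?_
  rw [mfderivWithin_eq_fderivWithin]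
  rfl

theorem pullbackForm_eventuallyEq {p : ℝ × ℝ} (hp : p ∈ strip) (w : ℝ × ℝ) :
    pullbackForm u w =ᶠ[𝓝[strip] p] fun q => (extChartAt (cotModel E) (u p) (u q)).2
      (fderivWithin ℝ (extChartAt (cotModel E) (u p) ∘ u) strip q w).1 := by
  have hc : ContinuousWithinAt u strip p := (hu p hp).continuousWithinAt
  have hc2 := contDiffWithinAt_extChartAt_comp hu hp
  filter_upwards [hc2.continuousWithinAt.eventually (tautologicalForm_mfderiv_extChartAt_symm (u p)),
    hc.preimage_mem_nhdsWithin (extChartAt_source_mem_nhds (I := cotModel E) (u p)), self_mem_nhdsWithin,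
    (hc2.eventually (by simp)).filter_mono (nhdsWithin_mono p (Set.subset_insert p strip))]
    with q h1 h2 h3 h4
  refine Eq.trans ?_ (h1 (u q) ((extChartAt (cotModel E) (u p)).left_inv h2).symm _)
  exact congrArg (fun z : E × (E →L[ℝ] ℝ) => tautologicalForm (u q) z)
    (mfderivWithin_eq_comp hu h3 h2 (h4.differentiableWithinAt (by simp)) w)

theorem contDiffOn_pullbackForm (w : ℝ × ℝ) : ContDiffOn ℝ 1 (pullbackForm u w) strip := by
  intro p hp
  have h := contDiffWithinAt_extChartAt_comp hu hp
  have h1 := h.fderivWithin_right (m := 1) uniqueDiffOn_strip (by norm_num) hp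
  refine ContDiffWithinAt.congr_of_eventuallyEq ?_ (pullbackForm_eventuallyEq hu hp w)
    ((pullbackForm_eventuallyEq hu hp w).self_of_nhdsWithin hp)
  exact (contDiff_snd.contDiffAt.comp_contDiffWithinAt p (h.of_le (by norm_num))).clm_apply
    (contDiff_fst.contDiffAt.comp_contDiffWithinAt p (h1.clm_apply contDiffWithinAt_const))

/-- Product rule for `λ(∂_w u) = p(∂_w q)`: the first term antisymmetrizes to `ω`, the second
contains a second derivative. -/
theorem fderivWithin_pullbackForm {p : ℝ × ℝ} (hp : p ∈ strip) (w z : ℝ × ℝ) :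
    fderivWithin ℝ (pullbackForm u w) strip p z =
      (fderivWithin ℝ (extChartAt (cotModel E) (u p) ∘ u) strip p z).2
        (fderivWithin ℝ (extChartAt (cotModel E) (u p) ∘ u) strip p w).1 +
      (extChartAt (cotModel E) (u p) (u p)).2
        (fderivWithin ℝ (fderivWithin ℝ (extChartAt (cotModel E) (u p) ∘ u) strip) strip p z w).1 := by
  have h := contDiffWithinAt_extChartAt_comp hu hp
  have h1 := h.fderivWithin_right (m := 1) uniqueDiffOn_strip (by norm_num) hp
  have hU := uniqueDiffOn_strip p hp
  have d0 := (h.differentiableWithinAt (by simp)).hasFDerivWithinAt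
  have d1 := (h1.differentiableWithinAt (by simp)).hasFDerivWithinAt
  have d2 := (hasFDerivAt_fst.comp_hasFDerivWithinAt p
    (d1.clm_apply (hasFDerivWithinAt_const w p strip)))
  have d3 := (hasFDerivAt_snd.comp_hasFDerivWithinAt p d0).clm_apply d2
  rw [(pullbackForm_eventuallyEq hu hp w).fderivWithin_eq
    ((pullbackForm_eventuallyEq hu hp w).self_of_nhdsWithin hp)]
  refine (congrArg (fun T : ℝ × ℝ →L[ℝ] ℝ => T z) (d3.fderivWithin hU)).trans ?_
  simp
  ring

/-- Naturality of the exterior derivative: `∂ₜ(λ(∂_τ u)) - ∂_τ(λ(∂ₜ u)) = ω(∂ₜ u, ∂_τ u)`. -/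
theorem fderivWithin_pullbackForm_sub {p : ℝ × ℝ} (hp : p ∈ strip) :
    fderivWithin ℝ (pullbackForm u (0, 1)) strip p (1, 0) -
      fderivWithin ℝ (pullbackForm u (1, 0)) strip p (0, 1) =
        symplecticForm (u p) (partialT u p) (partialTau u p) := by
  -- The second-derivative terms cancel by symmetry. This also holds on the boundary of the strip,
  -- whose points are limits of interior points.
  have hsymm := (contDiffWithinAt_extChartAt_comp hu hp).isSymmSndFDerivWithinAt (by simp)
    uniqueDiffOn_strip (strip_subset_closure_interior hp) hp
  rw [fderivWithin_pullbackForm hu hp, fderivWithin_pullbackForm hu hp,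
    hsymm.eq (1, 0) (0, 1), symplecticForm_apply, partialT, partialTau,
    mfderivWithin_eq_fderivWithin_extChartAt_comp hu hp, add_sub_add_right_eq_sub]
  rfl

end Strip

/-! ### Blow-up and Green's formula on the strip -/

section Analysis

/-- A function which satisfies `a' ≥ c a²` in integrated form on a half line is nonpositive there,
since otherwise it would blow up in finite time. -/
theorem nonpos_of_sq_growth {a : ℝ → ℝ} {c T : ℝ} (hc : 0 < c)
    (h : ∀ s t, T ≤ s → s ≤ t → 0 < a s → c * (t - s) * a s ^ 2 ≤ a t - a s) :
    ∀ t, T ≤ t → a t ≤ 0 := by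
  intro t ht
  by_contra! hpos
  have hmono : ∀ s r, T ≤ s → s ≤ r → 0 < a s → a s ≤ a r := fun s r hs hr h0 => by
    have h1 := h s r hs hr h0
    have h2 : 0 ≤ c * (r - s) * a s ^ 2 := by have := sub_nonneg.2 hr; positivity
    linarith
  -- Doubling times: waiting `1 / (c a(s))` adds at least `a(s)`. As `a(s) ≥ 2ⁿ a(t)`, the waiting
  -- times are dominated by a geometric series with sum `2 / (c a(t))`.
  have key : ∀ n : ℕ, ∃ s, t ≤ s ∧ s ≤ t + (2 - 2 * (1 / 2) ^ n) / (c * a t) ∧ 2 ^ n * a t ≤ a s := by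
    intro n
    induction n with
    | zero => exact ⟨t, le_rfl, by simp, by simp⟩
    | succ n ih =>
      obtain ⟨s, hs1, hs2, hs3⟩ := ih
      have hs0 : 0 < a s := lt_of_lt_of_le (by positivity) hs3
      refine ⟨s + 1 / (c * a s), hs1.trans (le_add_of_nonneg_right (by positivity)), ?_, ?_⟩
      · have h1 : 1 / (c * a s) ≤ 1 / (c * (2 ^ n * a t)) := by gcongr
        have h2 : (2 - 2 * (1 / 2 : ℝ) ^ (n + 1)) / (c * a t) =
            (2 - 2 * (1 / 2) ^ n) / (c * a t) + 1 / (c * (2 ^ n * a t)) := by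
          rw [one_div_pow, one_div_pow]
          field_simp
          ring
        linarith
      · have h1 := h s (s + 1 / (c * a s)) (ht.trans hs1)
          (le_add_of_nonneg_right (by positivity)) hs0
        have h2 : c * (s + 1 / (c * a s) - s) * a s ^ 2 = a s := by field_simp; ring
        rw [pow_succ]
        linarith
  -- All doubling times precede this one fixed time, so monotonicity makes the value there exceed
  -- every `2ⁿ a(t)`.
  have hbdd : ∀ n : ℕ, 2 ^ n * a t ≤ a (t + 2 / (c * a t)) := by
    intro n
    obtain ⟨s, hs1, hs2, hs3⟩ := key n
    have hs0 : 0 < a s := lt_of_lt_of_le (by positivity) hs3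
    refine hs3.trans (hmono s _ (ht.trans hs1) (hs2.trans ?_) hs0)
    gcongr
    have : (0 : ℝ) ≤ (1 / 2) ^ n := by positivity
    linarith
  obtain ⟨n, hn⟩ := pow_unbounded_of_one_lt (a (t + 2 / (c * a t)) / a t) (one_lt_two (α := ℝ))
  rw [div_lt_iff₀ hpos] at hn
  exact (hbdd n).not_gt hn

/-- The variance of `f` on the unit interval is nonnegative. -/
theorem sq_integral_le_integral_sq {f : ℝ → ℝ} (hf : Continuous f) :
    (∫ y in (0 : ℝ)..1, f y) ^ 2 ≤ ∫ y in (0 : ℝ)..1, f y ^ 2 := by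
  set m := ∫ y in (0 : ℝ)..1, f y with hm
  have h0 : 0 ≤ ∫ y in (0 : ℝ)..1, (f y - m) ^ 2 :=
    intervalIntegral.integral_nonneg zero_le_one fun y _ => sq_nonneg _
  have h1 : ∫ y in (0 : ℝ)..1, (f y - m) ^ 2 =
      (∫ y in (0 : ℝ)..1, f y ^ 2) - 2 * m * m + m ^ 2 := by
    have e : ∀ y, (f y - m) ^ 2 = f y ^ 2 - 2 * m * f y + m ^ 2 := fun y => by ring
    simp_rw [e]
    rw [intervalIntegral.integral_add, intervalIntegral.integral_sub,
      intervalIntegral.integral_const_mul, ← hm]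
    · simp
    all_goals exact Continuous.intervalIntegrable (by fun_prop) _ _
  nlinarith

/-- The continuous extension to the plane of a function on the strip. -/
def stripExtend (f : ℝ × ℝ → ℝ) (p : ℝ × ℝ) : ℝ :=
  f (p.1, Set.projIcc 0 1 zero_le_one p.2)

theorem stripExtend_eq (f : ℝ × ℝ → ℝ) {t τ : ℝ} (hτ : τ ∈ Set.Icc (0 : ℝ) 1) :
    stripExtend f (t, τ) = f (t, τ) := by
  simp only [stripExtend, Set.projIcc_of_mem _ hτ]

theorem continuous_stripExtend {f : ℝ × ℝ → ℝ} (hf : ContinuousOn f strip) :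
    Continuous (stripExtend f) :=
  hf.comp_continuous (by fun_prop) fun p => mem_strip.2 (Set.projIcc 0 1 zero_le_one p.2).2

theorem integral_stripExtend (f : ℝ × ℝ → ℝ) (t : ℝ) :
    ∫ y in (0 : ℝ)..1, stripExtend f (t, y) = ∫ y in (0 : ℝ)..1, f (t, y) :=
  intervalIntegral.integral_congr fun y hy => stripExtend_eq f (by rwa [Set.uIcc_of_le zero_le_one] at hy)

variable {f k : ℝ × ℝ → ℝ}

/-- The function `∂ₜ f - ∂_τ k` on the strip. -/
def stripCurl (f k : ℝ × ℝ → ℝ) (p : ℝ × ℝ) : ℝ :=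
  fderivWithin ℝ f strip p (1, 0) - fderivWithin ℝ k strip p (0, 1)

theorem continuousOn_stripCurl (hf : ContDiffOn ℝ 1 f strip) (hk : ContDiffOn ℝ 1 k strip) :
    ContinuousOn (stripCurl f k) strip :=
  ((hf.continuousOn_fderivWithin uniqueDiffOn_strip le_rfl).clm_apply continuousOn_const).sub
    ((hk.continuousOn_fderivWithin uniqueDiffOn_strip le_rfl).clm_apply continuousOn_const)

/-- Green's formula on a rectangle in the strip. -/
theorem integral_stripCurl (hf : ContDiffOn ℝ 1 f strip) (hk : ContDiffOn ℝ 1 k strip)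
    (h0 : ∀ t, k (t, 0) = 0) (h1 : ∀ t, k (t, 1) = 0) (s t : ℝ) :
    ∫ x in s..t, ∫ y in (0 : ℝ)..1, stripCurl f k (x, y) =
      (∫ y in (0 : ℝ)..1, f (t, y)) - ∫ y in (0 : ℝ)..1, f (s, y) := by
  have hsub : Set.uIcc s t ×ˢ Set.uIcc (0 : ℝ) 1 ⊆ strip := by
    rw [Set.uIcc_of_le zero_le_one]; exact Set.prod_mono (Set.subset_univ _) subset_rfl
  have hd : ∀ {F : ℝ × ℝ → ℝ}, ContDiffOn ℝ 1 F strip →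
      ∀ x ∈ Set.Ioo (min s t) (max s t) ×ˢ Set.Ioo (min (0 : ℝ) 1) (max 0 1) \ ∅,
        HasFDerivAt F (fderivWithin ℝ F strip x) x := by
    intro F hF x hx
    have hx' : x ∈ interior strip := by
      rw [interior_strip]; simpa using hx.1.2
    exact ((hF.differentiableOn one_ne_zero x (interior_subset hx')).hasFDerivWithinAt).hasFDerivAt
      (mem_interior_iff_mem_nhds.1 hx')
  have hi : MeasureTheory.IntegrableOn (fun x => fderivWithin ℝ f strip x (1, 0) +
      (-fderivWithin ℝ k strip x) (0, 1)) (Set.uIcc s t ×ˢ Set.uIcc (0 : ℝ) 1) := by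
    refine ContinuousOn.integrableOn_compact (isCompact_uIcc.prod isCompact_uIcc) ?_
    exact (continuousOn_stripCurl hf hk).mono hsub |>.congr fun x _ => by
      simp [stripCurl, sub_eq_add_neg]
  -- The divergence theorem for the field `(f, -k)`. The flux of `-k` through the sides `τ = 0` and
  -- `τ = 1` is zero.
  have h := MeasureTheory.integral2_divergence_prod_of_hasFDerivAt_off_countable f (fun p => -k p)
    (fderivWithin ℝ f strip) (fun p => -fderivWithin ℝ k strip p) s 0 t 1 ∅ Set.countable_empty
    (hf.continuousOn.mono hsub) (hk.continuousOn.neg.mono hsub) (hd hf)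
    (fun x hx => (hd hk x hx).neg) hi
  simp only [h0, h1, neg_zero, intervalIntegral.integral_zero, sub_zero, zero_add] at h
  refine Eq.trans ?_ h
  simp [stripCurl, sub_eq_add_neg]

/-- With `a` and `b` the integrals over `τ` of `f` and of the curl, `a' = b ≥ 0` and `a² ≤ C b` for
`|t| ≥ T`. Blow-up in both time directions forces `a = 0`, hence `b = 0`, and a continuous
nonnegative function with zero integral vanishes. -/
theorem stripCurl_eq_zero (hf : ContDiffOn ℝ 1 f strip) (hk : ContDiffOn ℝ 1 k strip)
    (h0 : ∀ t, k (t, 0) = 0) (h1 : ∀ t, k (t, 1) = 0) (he : ∀ p ∈ strip, 0 ≤ stripCurl f k p)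
    {C T : ℝ} (hC : 0 < C) (hbd : ∀ p ∈ strip, T ≤ |p.1| → f p ^ 2 ≤ C * stripCurl f k p) :
    ∀ p ∈ strip, stripCurl f k p = 0 := by
  set a : ℝ → ℝ := fun t => ∫ y in (0 : ℝ)..1, f (t, y) with ha
  set b : ℝ → ℝ := fun t => ∫ y in (0 : ℝ)..1, stripCurl f k (t, y) with hb
  have hec := continuous_stripExtend (continuousOn_stripCurl hf hk)
  have hfc := continuous_stripExtend hf.continuousOn
  have hbc : Continuous b := by
    rw [show b = _ from funext fun t => (integral_stripExtend (stripCurl f k) t).symm]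
    exact intervalIntegral.continuous_parametric_intervalIntegral_of_continuous' (by exact hec) 0 1
  have hb0 : ∀ x, 0 ≤ b x := fun x =>
    intervalIntegral.integral_nonneg zero_le_one fun y hy => he _ (mem_strip.2 hy)
  have hab : ∀ s t, a t - a s = ∫ x in s..t, b x := fun s t =>
    (integral_stripCurl hf hk h0 h1 s t).symm
  have hmono : ∀ s t, s ≤ t → a s ≤ a t := fun s t hst => by
    have := intervalIntegral.integral_nonneg (μ := MeasureTheory.volume) hst fun x _ => hb0 x
    linarith [hab s t]
  have hsq : ∀ x, T ≤ |x| → a x ^ 2 ≤ C * b x := by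
    intro x hx
    have hfx : Continuous fun y => stripExtend f (x, y) := by fun_prop
    have hex : Continuous fun y => stripExtend (stripCurl f k) (x, y) := by fun_prop
    rw [show a x = _ from (integral_stripExtend f x).symm,
      show b x = _ from (integral_stripExtend (stripCurl f k) x).symm]
    refine (sq_integral_le_integral_sq hfx).trans ?_
    rw [← intervalIntegral.integral_const_mul]
    refine intervalIntegral.integral_mono_on zero_le_one
      ((hfx.pow 2).intervalIntegrable _ _) ((continuous_const.mul hex).intervalIntegrable _ _) ?_
    intro y hy
    rw [stripExtend_eq _ hy, stripExtend_eq _ hy]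
    exact hbd _ (mem_strip.2 hy) hx
  have hgrow : ∀ s t m, s ≤ t → (∀ x ∈ Set.Icc s t, m ^ 2 ≤ C * b x) →
      C⁻¹ * (t - s) * m ^ 2 ≤ a t - a s := by
    intro s t m hst hm
    rw [hab]
    have h2 := intervalIntegral.integral_mono_on (μ := MeasureTheory.volume) hst (f := fun _ => C⁻¹ * m ^ 2) (g := b)
      (continuous_const.intervalIntegrable _ _) (hbc.intervalIntegrable _ _) fun x hx => by
        rw [inv_mul_le_iff₀ hC]; exact hm x hx
    rw [intervalIntegral.integral_const, smul_eq_mul] at h2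
    linarith
  -- Where `a(s) > 0`, monotonicity gives `a(s)² ≤ a(x)² ≤ C b(x)` for later `x`, which is the
  -- growth hypothesis. Values before `T` are bounded by later ones.
  have hle : ∀ t, a t ≤ 0 := by
    have h := nonpos_of_sq_growth (a := a) (T := T) (inv_pos.2 hC) fun s t hs hst hpos =>
      hgrow s t (a s) hst fun x hx => by
        refine le_trans ?_ (hsq x ((hs.trans hx.1).trans (le_abs_self x)))
        exact pow_le_pow_left₀ hpos.le (hmono s x hx.1) 2
    exact fun t => (hmono _ _ (le_max_left t T)).trans (h _ (le_max_right t T))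
  have hge : ∀ t, 0 ≤ a t := by
    -- Time reversal: `t ↦ -a(-t)` satisfies the same growth inequality, using the bound at the
    -- negative end.
    have h := nonpos_of_sq_growth (a := fun t => -a (-t)) (T := T) (inv_pos.2 hC)
      fun s t hs hst hpos => by
        have h1 := hgrow (-t) (-s) (-a (-s)) (neg_le_neg hst) fun x hx => by
          have hx' : s ≤ -x := by linarith [hx.2]
          refine le_trans ?_ (hsq x ((hs.trans hx').trans (neg_le_abs x)))
          rw [← neg_sq (a x)]
          exact pow_le_pow_left₀ hpos.le (neg_le_neg (hmono x (-s) hx.2)) 2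
        convert h1 using 1 <;> ring
    intro t
    have h2 := h _ (le_max_right (-t) T)
    have h3 := hmono (-max (-t) T) t (by linarith [le_max_left (-t) T])
    linarith
  have hb1 : ∀ x, b x = 0 := by
    intro x
    by_contra hx
    have h2 := intervalIntegral.integral_pos (lt_add_one x) hbc.continuousOn (fun y _ => hb0 y)
      ⟨x, Set.left_mem_Icc.2 (lt_add_one x).le, (hb0 x).lt_of_ne' hx⟩
    linarith [hab x (x + 1), hle (x + 1), hge x]
  rintro ⟨x, y⟩ hp
  by_contra hne
  have hy := mem_strip.1 hp
  have h2 := intervalIntegral.integral_pos zero_lt_one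
    (f := fun y => stripExtend (stripCurl f k) (x, y)) (by fun_prop)
    (fun z hz => by
      rw [stripExtend_eq _ (Set.Ioc_subset_Icc_self hz)]
      exact he _ (mem_strip.2 (Set.Ioc_subset_Icc_self hz)))
    ⟨y, hy, by rw [stripExtend_eq _ hy]; exact (he _ hp).lt_of_ne' hne⟩
  rw [integral_stripExtend] at h2
  exact h2.ne' (hb1 x)

end Analysis

/-! ### The energy identity and the vanishing of `∂_τ u` -/

section Energy

variable {E : Type*} [NormedAddCommGroup E] [NormedSpace ℝ E] [FiniteDimensional ℝ E]
  {M : Type*} [TopologicalSpace M] [ChartedSpace E M] [IsManifold 𝓘(ℝ, E) ∞ M]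

omit [FiniteDimensional ℝ E] [IsManifold 𝓘(ℝ, E) ∞ M] in
theorem eq_zeroCovector {ξ : CotangentBundle E M} (hξ : covector ξ = 0) :
    ξ = zeroCovector E ξ.proj := by
  obtain ⟨x, β⟩ := ξ
  exact congrArg (Bundle.TotalSpace.mk x) hξ

omit [FiniteDimensional ℝ E] in
theorem inner_self_nonneg (g : Metric E M) (x : M) (v : TangentSpace 𝓘(ℝ, E) x) :
    0 ≤ g.inner x v v := by
  by_cases h : v = 0
  · rw [h, map_zero]
  · exact (g.pos x v h).le

omit [FiniteDimensional ℝ E] in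
theorem eq_zero_of_inner_self_eq_zero (g : Metric E M) {x : M} {v : TangentSpace 𝓘(ℝ, E) x}
    (h : g.inner x v v = 0) : v = 0 := by
  by_contra h0
  exact (g.pos x v h0).ne' h

theorem sq_apply_le_of_symm {V : Type*} [AddCommGroup V] [Module ℝ V] [TopologicalSpace V]
    (G : V →L[ℝ] V →L[ℝ] ℝ) (hs : ∀ v w, G v w = G w v) (h0 : ∀ v, 0 ≤ G v v) (v w : V) :
    G v w ^ 2 ≤ G v v * G w w := by
  let B : LinearMap.BilinForm ℝ V := LinearMap.mk₂ ℝ (fun a b => G a b)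
    (by intros; simp) (by intros; simp) (by intros; simp) (by intros; simp)
  exact LinearMap.BilinForm.apply_sq_le_of_symm B h0 ⟨fun a b => hs a b⟩ v w

omit [FiniteDimensional ℝ E] in
theorem sq_inner_le (g : Metric E M) (x : M) (v w : TangentSpace 𝓘(ℝ, E) x) :
    g.inner x v w ^ 2 ≤ g.inner x v v * g.inner x w w :=
  sq_apply_le_of_symm (g.inner x) (g.symm x) (inner_self_nonneg g x) v w

theorem connectionTerm_zero (g : Metric E M) (ξ : CotangentBundle E M) :
    connectionTerm g ξ 0 = 0 := by
  refine ContinuousLinearMap.ext fun b => ?_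
  rw [connectionTerm_apply]
  have h : ∀ (D : E →L[ℝ] E →L[ℝ] E →L[ℝ] ℝ) (s : E), (D 0 b s + D b 0 s - D s 0 b) / 2 = 0 := by
    simp
  exact h _ _

theorem verticalPart_of_fst_eq_zero (g : Metric E M) {ξ : CotangentBundle E M}
    {z : TangentSpace (cotModel E) ξ} (hz : z.1 = 0) : verticalPart g ξ z = z.2 := by
  have h : connectionTerm g ξ z.1 = 0 := (congrArg _ hz).trans (connectionTerm_zero g ξ)
  exact (congrArg (fun T : E →L[ℝ] ℝ => (z.2 : E →L[ℝ] ℝ) - T) h).trans (sub_zero _)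

theorem almostComplex_zero (g : Metric E M) (ξ : CotangentBundle E M) :
    almostComplex g ξ 0 = 0 := by
  have h1 : verticalPart g ξ 0 = 0 := verticalPart_of_fst_eq_zero g (z := 0) rfl
  have h2 : dproj ξ 0 = 0 := map_zero _
  unfold almostComplex
  rw [h1, h2, map_zero, map_zero, neg_zero]
  refine Prod.ext rfl ?_
  exact (zero_add _).trans (connectionTerm_zero g ξ)

/-- By compatibility, the squared norms of the horizontal and vertical parts both vanish. Once the
base component is zero, the connection term drops out and the vertical part is the fibre coordinate.
-/
theorem eq_zero_of_symplecticForm_almostComplex (g : Metric E M) {ξ : CotangentBundle E M}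
    {z : TangentSpace (cotModel E) ξ} (h : symplecticForm ξ z (almostComplex g ξ z) = 0) :
    z = 0 := by
  rw [symplecticForm_almostComplex] at h
  have h1 := inner_self_nonneg g ξ.proj ((flat g ξ.proj).symm (verticalPart g ξ z))
  have h2 := inner_self_nonneg g ξ.proj (dproj ξ z)
  have h3 := eq_zero_of_inner_self_eq_zero g (le_antisymm (by linarith) h1)
  have h4 := eq_zero_of_inner_self_eq_zero g (le_antisymm (by linarith) h2)
  rw [dproj_apply] at h4
  have h5 := (flat g ξ.proj).symm.map_eq_zero_iff.1 h3
  rw [verticalPart_of_fst_eq_zero g h4] at h5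
  exact Prod.ext h4 h5

variable {g : Metric E M} {A : M → ℝ} {u : ℝ × ℝ → CotangentBundle E M}

omit [FiniteDimensional ℝ E] in
theorem pullbackForm_eq_zero {p : ℝ × ℝ} (hp : covector (u p) = 0) (w : ℝ × ℝ) :
    pullbackForm u w p = 0 := by
  unfold pullbackForm tautologicalForm
  rw [hp]
  rfl

theorem liftHamiltonian_eq_zero {ξ : CotangentBundle E M} (hξ : covector ξ = 0) :
    liftHamiltonian g A ξ = 0 := by
  unfold liftHamiltonian
  rw [hξ]
  rfl

section

variable (hA : ContMDiff 𝓘(ℝ, E) 𝓘(ℝ, ℝ) ∞ A)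
  (hu : ContMDiffOn 𝓘(ℝ, ℝ × ℝ) (cotModel E) 2 u strip)
include hA hu

theorem contDiffOn_liftHamiltonian_comp :
    ContDiffOn ℝ 1 (fun p => liftHamiltonian g A (u p)) strip :=
  (((contMDiff_liftHamiltonian g hA).of_le (by norm_num)).comp_contMDiffOn
    (hu.of_le (by norm_num))).contDiffOn

theorem fderivWithin_liftHamiltonian_comp {p : ℝ × ℝ} (hp : p ∈ strip) (w : ℝ × ℝ) :
    fderivWithin ℝ (fun p => liftHamiltonian g A (u p)) strip p w =
      dfun (liftHamiltonian g A) (u p)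
        (mfderivWithin 𝓘(ℝ, ℝ × ℝ) (cotModel E) u strip p w) := by
  have h := mfderiv_comp_mfderivWithin (I := 𝓘(ℝ, ℝ × ℝ)) p
    ((contMDiff_liftHamiltonian g hA (u p)).mdifferentiableAt (by simp))
    (mdifferentiableWithinAt_strip hu hp) (uniqueDiffOn_strip p hp).uniqueMDiffWithinAt
  rw [mfderivWithin_eq_fderivWithin] at h
  exact congrArg (fun T : ℝ × ℝ →L[ℝ] ℝ => T w) h

/-- The curl is `ω(∂ₜu, ∂_τ u) - ω(∂_τ u, X_H)`, that is `ω(∂_τ u, -∂ₜu - X_H)`, and the Floer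
equation identifies the second argument with `J ∂_τ u`. Adding `H(u)` to `λ(∂ₜu)` is what absorbs
the Hamiltonian term without any smallness of `A`. -/
theorem stripCurl_eq_energy {p : ℝ × ℝ} (hp : p ∈ strip)
    (heq : partialT u p + almostComplex g (u p) (partialTau u p) +
      hamiltonianVectorField (liftHamiltonian g A) (u p) = 0) :
    stripCurl (pullbackForm u (0, 1))
      (fun p => pullbackForm u (1, 0) p + liftHamiltonian g A (u p)) p =
        symplecticForm (u p) (partialTau u p) (almostComplex g (u p) (partialTau u p)) := by
  have hU := uniqueDiffOn_strip p hp
  have h1 := fderivWithin_pullbackForm_sub hu hp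
  have h2 := fderivWithin_liftHamiltonian_comp (g := g) hA hu hp (0, 1)
  have h3 := symplecticForm_hamiltonianVectorField (liftHamiltonian g A) (u p) (partialTau u p)
  have h4 : fderivWithin ℝ (fun p => pullbackForm u (1, 0) p + liftHamiltonian g A (u p)) strip p =
      fderivWithin ℝ (pullbackForm u (1, 0)) strip p +
        fderivWithin ℝ (fun p => liftHamiltonian g A (u p)) strip p :=
    fderivWithin_fun_add hU ((contDiffOn_pullbackForm hu (1, 0)).differentiableOn one_ne_zero p hp)
      ((contDiffOn_liftHamiltonian_comp hA hu).differentiableOn one_ne_zero p hp)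
  unfold stripCurl
  rw [h4, add_apply, h2]
  change _ - (_ + dfun (liftHamiltonian g A) (u p) (partialTau u p)) = _
  rw [← h3, ← sub_sub, h1]
  have h5 : almostComplex g (u p) (partialTau u p) = -partialT u p -
      hamiltonianVectorField (liftHamiltonian g A) (u p) := by
    rw [eq_sub_iff_add_eq, eq_neg_iff_add_eq_zero, ← heq]; abel
  rw [h5, symplecticForm_apply, symplecticForm_apply, symplecticForm_apply]
  have a1 : ∀ (z : E × (E →L[ℝ] ℝ)) (x y : E × (E →L[ℝ] ℝ)), x.2 z.1 - z.2 x.1 -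
      (z.2 y.1 - y.2 z.1) = z.2 (-x - y).1 - (-x - y).2 z.1 := by
    intro z x y; simp; ring
  exact a1 _ _ _

end

/-- Cauchy-Schwarz for `λ(∂_τ u) = g(s, dπ ∂_τ u)`, with `s` the vector dual to `u`. The norm of `s`
is bounded near the limit point, uniformly in `τ`. -/
theorem exists_pullbackForm_sq_le (g : Metric E M) {l : Filter ℝ} {ξ : CotangentBundle E M}
    (h : Filter.Tendsto u (l ×ˢ Filter.principal (Set.Icc 0 1)) (𝓝 ξ)) :
    ∃ C : ℝ, ∀ᶠ t in l, ∀ τ ∈ Set.Icc (0 : ℝ) 1, pullbackForm u (0, 1) (t, τ) ^ 2 ≤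
      C * symplecticForm (u (t, τ)) (partialTau u (t, τ))
        (almostComplex g (u (t, τ)) (partialTau u (t, τ))) := by
  obtain ⟨C, hC⟩ := eventually_covector_flat_symm_le g ξ
  refine ⟨C, ?_⟩
  filter_upwards [Filter.eventually_prod_principal_iff.1 (h.eventually hC)] with t ht τ hτ
  have h1 := ht τ hτ
  set p := (t, τ)
  rw [symplecticForm_almostComplex]
  set s := (flat g (u p).proj).symm (covector (u p))
  have h2 : pullbackForm u (0, 1) p = g.inner (u p).proj s (dproj (u p) (partialTau u p)) :=
    (inner_flat_symm g _ _ _).symm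
  have h3 : g.inner (u p).proj s s ≤ C := (inner_flat_symm g _ _ _).trans_le h1
  have h4 := sq_inner_le g (u p).proj s (dproj (u p) (partialTau u p))
  have h5 := inner_self_nonneg g (u p).proj s
  have h6 := inner_self_nonneg g (u p).proj (dproj (u p) (partialTau u p))
  have h7 := inner_self_nonneg g (u p).proj
    ((flat g (u p).proj).symm (verticalPart g (u p) (partialTau u p)))
  rw [h2]
  -- The energy density exceeds the squared norm of the horizontal part by that of the vertical
  -- part, and `C ≥ 0` because it bounds a squared norm.
  nlinarith [mul_le_mul_of_nonneg_right h3 h6, mul_nonneg (h5.trans h3) h7]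

theorem IsFloerStrip.partialTau_eq_zero (hA : ContMDiff 𝓘(ℝ, E) 𝓘(ℝ, ℝ) ∞ A)
    (hu : IsFloerStrip g (liftHamiltonian g A) u) : ∀ p ∈ strip, partialTau u p = 0 := by
  have he : ∀ p ∈ strip, _ := fun p hp => stripCurl_eq_energy hA hu.contMDiffOn hp (hu.equation p hp)
  have hnonneg : ∀ p, 0 ≤ symplecticForm (u p) (partialTau u p)
      (almostComplex g (u p) (partialTau u p)) := fun p => by
    rw [symplecticForm_almostComplex]
    exact add_nonneg (inner_self_nonneg g _ _) (inner_self_nonneg g _ _)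
  obtain ⟨ξ₁, -, h₁⟩ := hu.tendsto_atBot
  obtain ⟨ξ₂, -, h₂⟩ := hu.tendsto_atTop
  obtain ⟨C₁, hC₁⟩ := exists_pullbackForm_sq_le g h₁
  obtain ⟨C₂, hC₂⟩ := exists_pullbackForm_sq_le g h₂
  obtain ⟨T₁, hT₁⟩ := Filter.eventually_atBot.1 hC₁
  obtain ⟨T₂, hT₂⟩ := Filter.eventually_atTop.1 hC₂
  have hzero := stripCurl_eq_zero (contDiffOn_pullbackForm hu.contMDiffOn (0, 1))
    ((contDiffOn_pullbackForm hu.contMDiffOn (1, 0)).add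
      (contDiffOn_liftHamiltonian_comp (g := g) hA hu.contMDiffOn))
    (fun t => by
      rw [pullbackForm_eq_zero (hu.boundary_zero t), liftHamiltonian_eq_zero (hu.boundary_zero t),
        add_zero])
    (fun t => by
      rw [pullbackForm_eq_zero (hu.boundary_one t), liftHamiltonian_eq_zero (hu.boundary_one t),
        add_zero])
    (fun p hp => (he p hp).symm ▸ hnonneg p)
    -- One constant for both ends; the `1` makes it positive. The condition `|t| ≥ T` puts `t` below
    -- `T₁` or above `T₂`.
    (C := max 1 (max C₁ C₂)) (T := max (-T₁) T₂) (lt_max_of_lt_left one_pos) ?_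
  · intro p hp
    exact eq_zero_of_symplecticForm_almostComplex g ((he p hp).symm.trans (hzero p hp))
  · rintro ⟨t, τ⟩ hp ht
    have hτ := mem_strip.1 hp
    rw [he _ hp]
    rcases le_abs.1 ht with ht | ht
    · refine (hT₂ t ((le_max_right _ _).trans ht) τ hτ).trans
        (mul_le_mul_of_nonneg_right ?_ (hnonneg _))
      exact (le_max_right _ _).trans (le_max_right _ _)
    · refine (hT₁ t (by linarith [(le_max_left (-T₁) T₂).trans ht]) τ hτ).trans
        (mul_le_mul_of_nonneg_right ?_ (hnonneg _))
      exact (le_max_left _ _).trans (le_max_right _ _)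

end Energy

/-! ### Constancy in `τ`, and limits in the zero section -/

section Constancy

variable {E : Type*} [NormedAddCommGroup E] [NormedSpace ℝ E]
  {M : Type*} [TopologicalSpace M] [ChartedSpace E M] [IsManifold 𝓘(ℝ, E) ∞ M]
  {u : ℝ × ℝ → CotangentBundle E M}

theorem fderivWithin_extChartAt_comp_eq_zero
    (hu : ContMDiffOn 𝓘(ℝ, ℝ × ℝ) (cotModel E) 2 u strip) {p q : ℝ × ℝ} (hq : q ∈ strip)
    (hs : u q ∈ (extChartAt (cotModel E) (u p)).source) (h : partialTau u q = 0) :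
    fderivWithin ℝ (extChartAt (cotModel E) (u p) ∘ u) strip q (0, 1) = 0 := by
  have hc : MDifferentiableAt (cotModel E) 𝓘(ℝ, E × (E →L[ℝ] ℝ)) (extChartAt (cotModel E) (u p))
      (u q) := mdifferentiableAt_extChartAt (by rwa [extChartAt_source] at hs)
  have h1 := mfderiv_comp_mfderivWithin (I := 𝓘(ℝ, ℝ × ℝ)) q hc (mdifferentiableWithinAt_strip hu hq)
    (uniqueDiffOn_strip q hq).uniqueMDiffWithinAt
  rw [mfderivWithin_eq_fderivWithin] at h1
  have h2 := congrArg (fun T : ℝ × ℝ →L[ℝ] E × (E →L[ℝ] ℝ) => T (0, 1)) h1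
  refine h2.trans ?_
  change mfderiv (cotModel E) 𝓘(ℝ, E × (E →L[ℝ] ℝ)) (extChartAt (cotModel E) (u p)) (u q)
    (partialTau u q) = 0
  rw [h]
  exact map_zero _

/-- In a single chart the `τ`-derivative vanishes on a convex piece of `[0, 1]`, so the mean value
inequality with constant `0` applies, and the chart is injective. -/
theorem eventually_eq_of_partialTau_eq_zero
    (hu : ContMDiffOn 𝓘(ℝ, ℝ × ℝ) (cotModel E) 2 u strip) (h : ∀ p ∈ strip, partialTau u p = 0)
    (t : ℝ) {τ : ℝ} (hτ : τ ∈ Set.Icc (0 : ℝ) 1) :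
    ∀ᶠ σ in 𝓝[Set.Icc 0 1] τ, u (t, σ) = u (t, τ) := by
  set p : ℝ × ℝ := (t, τ) with hpdef
  have hp : p ∈ strip := mem_strip.2 hτ
  set φ := extChartAt (cotModel E) (u p) with hφ
  have hgood : ∀ᶠ q in 𝓝[strip] p, u q ∈ φ.source ∧ DifferentiableWithinAt ℝ (φ ∘ u) strip q := by
    have hc2 := contDiffWithinAt_extChartAt_comp hu hp
    filter_upwards [(hu p hp).continuousWithinAt.preimage_mem_nhdsWithin
      (extChartAt_source_mem_nhds (I := cotModel E) (u p)),
      (hc2.eventually (by simp)).filter_mono (nhdsWithin_mono p (Set.subset_insert p strip))]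
      with q h2 h4
    exact ⟨h2, h4.differentiableWithinAt (by simp)⟩
  obtain ⟨ε, hε, hball⟩ := Metric.mem_nhdsWithin_iff.1 hgood
  set S : Set ℝ := Metric.ball τ ε ∩ Set.Icc 0 1
  have hS : ∀ σ ∈ S, (t, σ) ∈ strip ∧ u (t, σ) ∈ φ.source ∧
      DifferentiableWithinAt ℝ (φ ∘ u) strip (t, σ) := by
    intro σ hσ
    have h1 : (t, σ) ∈ strip := mem_strip.2 hσ.2
    refine ⟨h1, hball ⟨?_, h1⟩⟩
    rw [hpdef, ← ball_prod_same]
    exact ⟨Metric.mem_ball_self hε, hσ.1⟩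
  have hd : ∀ σ ∈ S, HasDerivWithinAt (fun σ => φ (u (t, σ))) 0 S σ := by
    intro σ hσ
    obtain ⟨h1, h2, h3⟩ := hS σ hσ
    have hl : HasDerivWithinAt (fun σ : ℝ => (t, σ)) (0, 1) S σ :=
      (hasDerivWithinAt_const σ S t).prodMk (hasDerivWithinAt_id σ S)
    have h4 := h3.hasFDerivWithinAt.comp_hasDerivWithinAt σ hl fun r hr => (hS r hr).1
    rwa [fderivWithin_extChartAt_comp_eq_zero hu h1 h2 (h _ h1)] at h4
  have hconv : Convex ℝ S := (convex_ball τ ε).inter (convex_Icc 0 1)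
  have hτS : τ ∈ S := ⟨Metric.mem_ball_self hε, hτ⟩
  filter_upwards [inter_mem_nhdsWithin (Set.Icc (0 : ℝ) 1) (Metric.ball_mem_nhds τ hε)] with σ hσ
  have hσS : σ ∈ S := ⟨hσ.2, hσ.1⟩
  have h5 := hconv.norm_image_sub_le_of_norm_hasDerivWithin_le (C := 0) hd (by simp) hτS hσS
  rw [zero_mul, norm_le_zero_iff, sub_eq_zero] at h5
  exact φ.injOn (hS σ hσS).2.1 (hS τ hτS).2.1 h5

/-- Charts give only local constancy; connectedness of `[0, 1]` makes it global. -/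
theorem eq_of_partialTau_eq_zero
    (hu : ContMDiffOn 𝓘(ℝ, ℝ × ℝ) (cotModel E) 2 u strip) (h : ∀ p ∈ strip, partialTau u p = 0)
    (t : ℝ) {τ : ℝ} (hτ : τ ∈ Set.Icc (0 : ℝ) 1) : u (t, τ) = u (t, 0) := by
  have hloc : IsLocallyConstant fun σ : Set.Icc (0 : ℝ) 1 => u (t, σ) :=
    (IsLocallyConstant.iff_eventually_eq _).2 fun σ => by
      have h1 := eventually_eq_of_partialTau_eq_zero hu h t σ.2
      rwa [nhdsWithin_eq_map_subtype_coe σ.2, Filter.eventually_map] at h1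
  have : PreconnectedSpace (Set.Icc (0 : ℝ) 1) := Subtype.preconnectedSpace isPreconnected_Icc
  exact hloc.apply_eq_of_preconnectedSpace ⟨τ, hτ⟩ ⟨0, by simp⟩

theorem extChartAt_snd_eq_zero {ξ η : CotangentBundle E M}
    (hs : η ∈ (extChartAt (cotModel E) ξ).source) (hη : covector η = 0) :
    (extChartAt (cotModel E) ξ η).2 = 0 := by
  refine ContinuousLinearMap.ext fun a => ?_
  have h := covector_chartFrame ((extChartAt (cotModel E) ξ).map_source hs) a
  rw [(extChartAt (cotModel E) ξ).left_inv hs, hη] at h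
  exact h.symm

/-- The zero section is closed: the fibre coordinate in the chart at the limit is continuous and
vanishes along `w`. Hence critical points of `H` reached by a strip are zero covectors over critical
points of `A`. -/
theorem covector_eq_zero_of_tendsto {l : Filter ℝ} [l.NeBot] {w : ℝ → CotangentBundle E M}
    {ξ : CotangentBundle E M} (hw : ∀ t, covector (w t) = 0) (h : Filter.Tendsto w l (𝓝 ξ)) :
    covector ξ = 0 := by
  have h1 : Filter.Tendsto (fun t => (extChartAt (cotModel E) ξ (w t)).2) l
      (𝓝 (extChartAt (cotModel E) ξ ξ).2) :=
    (continuous_snd.tendsto _).comp ((continuousAt_extChartAt ξ).tendsto.comp h)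
  have h2 : (fun t => (extChartAt (cotModel E) ξ (w t)).2) =ᶠ[l] fun _ => 0 := by
    filter_upwards [h.eventually (extChartAt_source_mem_nhds (I := cotModel E) ξ)] with t ht
    exact extChartAt_snd_eq_zero ht (hw t)
  exact (extChartAt_self_snd ξ).symm.trans
    (tendsto_nhds_unique_of_eventuallyEq h1 tendsto_const_nhds h2)

end Constancy

/-! ### From Floer strips to gradient trajectories -/

section Solutions

variable {E : Type*} [NormedAddCommGroup E] [NormedSpace ℝ E] [FiniteDimensional ℝ E]
  {M : Type*} [TopologicalSpace M] [ChartedSpace E M] [IsManifold 𝓘(ℝ, E) ∞ M]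
  {g : Metric E M} {A : M → ℝ}

theorem exists_critical_tendsto_proj (hA : ContMDiff 𝓘(ℝ, E) 𝓘(ℝ, ℝ) ∞ A) {l : Filter ℝ} [l.NeBot]
    {u : ℝ × ℝ → CotangentBundle E M} (hz : ∀ t, covector (u (t, 0)) = 0)
    (h : ∃ ξ, IsCritical (liftHamiltonian g A) ξ ∧
      Filter.Tendsto u (l ×ˢ Filter.principal (Set.Icc 0 1)) (𝓝 ξ)) :
    ∃ x, mfderiv 𝓘(ℝ, E) 𝓘(ℝ, ℝ) A x = 0 ∧ Filter.Tendsto (fun t => (u (t, 0)).proj) l (𝓝 x) := by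
  obtain ⟨ξ, hξ, ht⟩ := h
  have h1 : Filter.Tendsto (fun t : ℝ => (t, (0 : ℝ))) l (l ×ˢ Filter.principal (Set.Icc 0 1)) :=
    Filter.tendsto_id.prodMk (Filter.tendsto_principal.2 (by simp))
  have h2 := ht.comp h1
  have h3 : covector ξ = 0 := covector_eq_zero_of_tendsto hz h2
  refine ⟨ξ.proj, (isCritical_liftHamiltonian_iff g hA h3).1 hξ, ?_⟩
  exact ((FiberBundle.continuous_proj (E →L[ℝ] ℝ) (fun x : M => TangentSpace 𝓘(ℝ, E) x →L[ℝ]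
    Bundle.Trivial M ℝ x)).tendsto ξ).comp h2

theorem IsFloerStrip.isGradientTrajectory (hA : ContMDiff 𝓘(ℝ, E) 𝓘(ℝ, ℝ) ∞ A)
    {u : ℝ × ℝ → CotangentBundle E M} (hu : IsFloerStrip g (liftHamiltonian g A) u) :
    IsGradientTrajectory g A fun t => (u (t, 0)).proj where
  equation t := by
    have hp : (t, (0 : ℝ)) ∈ strip := mem_strip.2 (by simp)
    have h1 := (mdifferentiableWithinAt_strip hu.contMDiffOn hp).hasMFDerivWithinAt
    have h2 : HasMFDerivWithinAt 𝓘(ℝ, ℝ) 𝓘(ℝ, ℝ × ℝ) (fun t : ℝ => (t, (0 : ℝ))) Set.univ t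
        (ContinuousLinearMap.inl ℝ ℝ ℝ) :=
      (ContinuousLinearMap.inl ℝ ℝ ℝ).hasFDerivAt.hasMFDerivAt.hasMFDerivWithinAt
    have h3 := HasMFDerivWithinAt.comp t h1 h2 fun s _ => mem_strip.2 (by simp)
    have h4 : HasMFDerivAt (cotModel E) 𝓘(ℝ, E)
        (Bundle.TotalSpace.proj : CotangentBundle E M → M) (u (t, 0)) (dproj (u (t, 0))) :=
      MDifferentiableAt.hasMFDerivAt (Bundle.mdifferentiableAt_proj _)
    have h5 := HasMFDerivAt.comp_hasMFDerivWithinAt t h4 h3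
    rw [hasMFDerivWithinAt_univ] at h5
    -- With `∂_τ u = 0` the equation is `∂ₜu = -X_H(u)`, and the base component of `X_H` is the
    -- gradient.
    have h6 : dproj (u (t, 0)) (partialT u (t, 0)) = -grad g A (u (t, 0)).proj := by
      have e := hu.equation _ hp
      rw [hu.partialTau_eq_zero hA _ hp, almostComplex_zero, add_zero] at e
      rw [eq_neg_of_add_eq_zero_left e, map_neg, dproj_apply, hamiltonianVectorField_fst g hA]
    refine h5.congr_mfderiv ?_
    refine ContinuousLinearMap.ext_ring ?_
    refine h6.trans ?_
    exact (one_smul ℝ (-grad g A (u (t, 0)).proj : E)).symm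
  tendsto_atBot := exists_critical_tendsto_proj hA hu.boundary_zero hu.tendsto_atBot
  tendsto_atTop := exists_critical_tendsto_proj hA hu.boundary_zero hu.tendsto_atTop

theorem IsFloerStrip.eq_zeroCovector (hA : ContMDiff 𝓘(ℝ, E) 𝓘(ℝ, ℝ) ∞ A)
    {u : ℝ × ℝ → CotangentBundle E M} (hu : IsFloerStrip g (liftHamiltonian g A) u)
    {p : ℝ × ℝ} (hp : p ∈ strip) : u p = zeroCovector E (u (p.1, 0)).proj :=
  (eq_of_partialTau_eq_zero hu.contMDiffOn (hu.partialTau_eq_zero hA) p.1 (mem_strip.1 hp)).trans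
    (CotangentFloer.eq_zeroCovector (hu.boundary_zero p.1))

end Solutions

/-! ### From gradient trajectories to Floer strips -/

section GradientTrajectories

/-- Solutions of a smooth autonomous differential equation are smooth. -/
theorem contDiffAt_of_hasDerivAt_comp {V : Type*} [NormedAddCommGroup V] [NormedSpace ℝ V]
    {F : V → V} {f : ℝ → V} {t : ℝ} (hF : ContDiffAt ℝ ∞ F (f t))
    (hf : ∀ᶠ s in 𝓝 t, HasDerivAt f (F (f s)) s) (n : ℕ) : ContDiffAt ℝ n f t := by
  induction n with
  | zero =>
    exact contDiffAt_zero.2 ⟨_, hf, fun s hs => (HasDerivAt.continuousAt hs).continuousWithinAt⟩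
  | succ n ih =>
    rw [Nat.cast_add, Nat.cast_one, contDiffAt_succ_iff_hasFDerivAt]
    refine ⟨fun s => ContinuousLinearMap.toSpanSingleton ℝ (F (f s)),
      ⟨_, hf, fun s hs => HasDerivAt.hasFDerivAt hs⟩, ?_⟩
    -- Bootstrapping: `f' = F ∘ f` is as regular as `f`, so `f` gains one derivative.
    have h : ContDiffAt ℝ n (fun s => F (f s)) t :=
      ContDiffAt.comp t (hF.of_le (by exact_mod_cast le_top)) ih
    exact (ContinuousLinearMap.toSpanSingletonCLE (𝕜 := ℝ) (E := V)).contDiff.contDiffAt.comp t h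

variable {E : Type*} [NormedAddCommGroup E] [NormedSpace ℝ E] [FiniteDimensional ℝ E]
  {M : Type*} [TopologicalSpace M] [ChartedSpace E M] [IsManifold 𝓘(ℝ, E) ∞ M]
  {g : Metric E M} {A : M → ℝ} {v : ℝ → M}

/-- The chart is fixed while the curve moves, so the trajectory solves an autonomous equation in
`E`, to which the bootstrapping applies. -/
theorem hasDerivAt_extChartAt_comp (hA : ContMDiff 𝓘(ℝ, E) 𝓘(ℝ, ℝ) ∞ A)
    (hv : IsMIntegralCurve (I := 𝓘(ℝ, E)) v (fun x => -grad g A x)) {x : M} {t : ℝ}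
    (ht : v t ∈ (extChartAt 𝓘(ℝ, E) x).source) :
    HasDerivAt (extChartAt 𝓘(ℝ, E) x ∘ v)
      (-gradInChart g A x (extChartAt 𝓘(ℝ, E) x (v t))) t := by
  have hc : MDifferentiableAt 𝓘(ℝ, E) 𝓘(ℝ, E) (extChartAt 𝓘(ℝ, E) x) (v t) :=
    mdifferentiableAt_extChartAt (by rwa [extChartAt_source] at ht)
  have h2 := chartFrame_gradInChart g hA ((extChartAt 𝓘(ℝ, E) x).map_source ht)
  have h3 := mfderiv_extChartAt_comp_mfderivWithin_extChartAt_symm' (I := 𝓘(ℝ, E)) ht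
  rw [ModelWithCorners.range_eq_univ, mfderivWithin_univ] at h3
  let D : E →L[ℝ] E := mfderiv 𝓘(ℝ, E) 𝓘(ℝ, E) (extChartAt 𝓘(ℝ, E) x) (v t)
  let a : E := grad g A (v t)
  have h1 : HasFDerivAt (extChartAt 𝓘(ℝ, E) x ∘ v) (D.comp ((1 : ℝ →L[ℝ] ℝ).smulRight (-a))) t :=
    (HasMFDerivAt.comp t hc.hasMFDerivAt (hv t)).hasFDerivAt
  have h4 : D a = gradInChart g A x (extChartAt 𝓘(ℝ, E) x (v t)) := by
    rw [(extChartAt 𝓘(ℝ, E) x).left_inv ht] at h2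
    refine (congrArg D h2.symm).trans ?_
    exact congrArg (fun T : E →L[ℝ] E => T (gradInChart g A x (extChartAt 𝓘(ℝ, E) x (v t)))) h3
  refine h1.hasDerivAt.congr_deriv ?_
  rw [← h4]
  simp

theorem contMDiff_of_isMIntegralCurve_grad (hA : ContMDiff 𝓘(ℝ, E) 𝓘(ℝ, ℝ) ∞ A)
    (hv : IsMIntegralCurve (I := 𝓘(ℝ, E)) v (fun x => -grad g A x)) (n : ℕ) :
    ContMDiff 𝓘(ℝ, ℝ) 𝓘(ℝ, E) n v := by
  intro t
  rw [contMDiffAt_iff_target]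
  have hc : ContinuousAt v t := (hv t).continuousAt
  refine ⟨hc, ContDiffAt.contMDiffAt ?_⟩
  refine contDiffAt_of_hasDerivAt_comp (F := fun e => -gradInChart g A (v t) e)
    (contDiffAt_gradInChart g hA (v t)).neg ?_ n
  filter_upwards [hc.eventually (extChartAt_source_mem_nhds (I := 𝓘(ℝ, E)) (v t))] with s hs
  exact hasDerivAt_extChartAt_comp hA hv hs

omit [FiniteDimensional ℝ E] in
theorem contMDiff_zeroCovector (n : ℕ) :
    ContMDiff 𝓘(ℝ, E) (cotModel E) n (zeroCovector E : M → CotangentBundle E M) :=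
  (Bundle.contMDiff_zeroSection ℝ (n := ∞)
    (fun x : M => TangentSpace 𝓘(ℝ, E) x →L[ℝ] Bundle.Trivial M ℝ x)).of_le
      (by exact_mod_cast le_top)

/-- In canonical coordinates the map is `(q(t), 0)` near `p`, so its derivative has no fibre
component and no `τ`-dependence. -/
theorem mfderivWithin_zeroCovector_comp (hA : ContMDiff 𝓘(ℝ, E) 𝓘(ℝ, ℝ) ∞ A)
    (hv : IsMIntegralCurve (I := 𝓘(ℝ, E)) v (fun x => -grad g A x))
    (hu : ContMDiffOn 𝓘(ℝ, ℝ × ℝ) (cotModel E) 2 (fun p : ℝ × ℝ => zeroCovector E (v p.1)) strip)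
    {p : ℝ × ℝ} (hp : p ∈ strip) (w : ℝ × ℝ) :
    mfderivWithin 𝓘(ℝ, ℝ × ℝ) (cotModel E) (fun p : ℝ × ℝ => zeroCovector E (v p.1)) strip p w =
      ((w.1 • -grad g A (v p.1) : E), (0 : E →L[ℝ] ℝ)) := by
  rw [mfderivWithin_eq_fderivWithin_extChartAt_comp hu hp]
  set φ := extChartAt (cotModel E) (zeroCovector E (v p.1))
  have hev : (φ ∘ fun p : ℝ × ℝ => zeroCovector E (v p.1)) =ᶠ[𝓝[strip] p]
      fun q => ((extChartAt 𝓘(ℝ, E) (v p.1) ∘ v) q.1, (0 : E →L[ℝ] ℝ)) := by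
    filter_upwards [(hu p hp).continuousWithinAt.preimage_mem_nhdsWithin
      (extChartAt_source_mem_nhds (I := cotModel E) (zeroCovector E (v p.1)))] with q hq
    exact Prod.ext rfl (extChartAt_snd_eq_zero hq rfl)
  have h1 := (hasDerivAt_extChartAt_comp hA hv (mem_extChartAt_source (I := 𝓘(ℝ, E)) (v p.1))).hasFDerivAt
  have h2 : HasFDerivAt (fun q : ℝ × ℝ => (extChartAt 𝓘(ℝ, E) (v p.1) ∘ v) q.1) _ p :=
    HasFDerivAt.comp (f := Prod.fst) p h1 (hasFDerivAt_fst (𝕜 := ℝ))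
  have h3 := (h2.prodMk (hasFDerivAt_const (0 : E →L[ℝ] ℝ) p)).hasFDerivWithinAt (s := strip)
  rw [hev.fderivWithin_eq (hev.self_of_nhdsWithin hp), h3.fderivWithin (uniqueDiffOn_strip p hp),
    gradInChart_self g hA]
  rfl

theorem IsGradientTrajectory.isFloerStrip (hA : ContMDiff 𝓘(ℝ, E) 𝓘(ℝ, ℝ) ∞ A)
    (hv : IsGradientTrajectory g A v) :
    IsFloerStrip g (liftHamiltonian g A) fun p => zeroCovector E (v p.1) := by
  have hu : ContMDiffOn 𝓘(ℝ, ℝ × ℝ) (cotModel E) 2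
      (fun p : ℝ × ℝ => zeroCovector E (v p.1)) strip :=
    ((contMDiff_zeroCovector 2).comp
      ((contMDiff_of_isMIntegralCurve_grad hA hv.equation 2).comp
        contDiff_fst.contMDiff)).contMDiffOn
  have hlim : ∀ {l : Filter ℝ}, (∃ x, mfderiv 𝓘(ℝ, E) 𝓘(ℝ, ℝ) A x = 0 ∧ Filter.Tendsto v l (𝓝 x)) →
      ∃ ξ, IsCritical (liftHamiltonian g A) ξ ∧
        Filter.Tendsto (fun p : ℝ × ℝ => zeroCovector E (v p.1))
          (l ×ˢ Filter.principal (Set.Icc 0 1)) (𝓝 ξ) := by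
    rintro l ⟨x, hx, hl⟩
    refine ⟨zeroCovector E x, (isCritical_liftHamiltonian_iff g hA rfl).2 hx, ?_⟩
    exact ((contMDiff_zeroCovector 0).continuous.tendsto x).comp
      (hl.comp Filter.tendsto_fst)
  refine ⟨hu, fun p hp => ?_, fun t => rfl, fun t => rfl, hlim hv.tendsto_atBot,
    hlim hv.tendsto_atTop⟩
  have hτ : partialTau (fun p : ℝ × ℝ => zeroCovector E (v p.1)) p = 0 := by
    refine (mfderivWithin_zeroCovector_comp hA hv.equation hu hp (0, 1)).trans ?_
    exact Prod.ext (zero_smul ℝ (-grad g A (v p.1) : E)) rfl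
  have ht := mfderivWithin_zeroCovector_comp hA hv.equation hu hp (1, 0)
  rw [hτ, almostComplex_zero, add_zero]
  -- The remaining equation `∂ₜu + X_H(u) = 0` is checked componentwise, with `X_H = (∇A, 0)` on the
  -- zero section.
  have hX1 := hamiltonianVectorField_fst g hA (zeroCovector E (v p.1))
  have hX2 := hamiltonianVectorField_snd g hA (ξ := zeroCovector E (v p.1)) rfl
  rw [add_eq_zero_iff_eq_neg]
  refine ht.trans (Prod.ext ?_ ?_)
  · refine (one_smul ℝ (-grad g A (v p.1) : E)).trans ?_
    exact congrArg (fun z : E => -z) hX1.symm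
  · exact neg_zero.symm.trans (congrArg (fun z : E →L[ℝ] ℝ => -z) hX2.symm)

end GradientTrajectories
end CotangentFloer
end

theorem mainTheorem7
    {E : Type*} [NormedAddCommGroup E] [NormedSpace ℝ E] [FiniteDimensional ℝ E]
    {M : Type*} [TopologicalSpace M] [T2Space M] [ChartedSpace E M] [IsManifold 𝓘(ℝ, E) ∞ M]
    (g : CotangentFloer.Metric E M) (A : M → ℝ) (hA : ContMDiff 𝓘(ℝ, E) 𝓘(ℝ, ℝ) ∞ A)
    (hMorse : CotangentFloer.IsMorse (E := E) A) :
    (∀ u : ℝ × ℝ → CotangentFloer.CotangentBundle E M,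
      CotangentFloer.IsFloerStrip g (CotangentFloer.liftHamiltonian g A) u →
        (∀ p ∈ CotangentFloer.strip, CotangentFloer.partialTau u p = 0) ∧
        (∀ p ∈ CotangentFloer.strip, CotangentFloer.covector (u p) = 0) ∧
        ∃ v : ℝ → M, CotangentFloer.IsGradientTrajectory g A v ∧
          ∀ p ∈ CotangentFloer.strip, u p = CotangentFloer.zeroCovector E (v p.1)) ∧
    (∀ v : ℝ → M, CotangentFloer.IsGradientTrajectory g A v →
      CotangentFloer.IsFloerStrip g (CotangentFloer.liftHamiltonian g A)
        (fun p => CotangentFloer.zeroCovector E (v p.1))) := by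
  refine ⟨fun u hu => ⟨hu.partialTau_eq_zero hA, fun p hp => ?_, _, hu.isGradientTrajectory hA,
    fun p hp => hu.eq_zeroCovector hA hp⟩, fun v hv => hv.isFloerStrip hA⟩
  rw [hu.eq_zeroCovector hA hp]
  rfl
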